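/- **Long finite sequences.** For a word $s=s_1s_2\cdots s_N$ and $1\le i\le N/2$ put $s^{(i)}=s_is_{i+1}\cdots s_{2i}$. The word $s$ has property $(*)$ if there are no $1\le i<j\le N/2$ such that $s^{(i)}$ is a subword (a not necessarily contiguous subsequence) of $s^{(j)}$. For $k\ge 1$ let $n(k)$ be the length of a longest word with property $(*)$ over an alphabet of $k$ letters; this maximum exists. **Turing machines.** A $\mathrm{TM}(n,m)$ is a deterministic machine with one tape, infinite in both directions, with $n$ states (the halting state HALT is not counted) and $m$ tape symbols (the blank is counted). In one step it reads the scanned symbol, writes a symbol, moves its head one cell to the left or to the right, and enters a new state or HALT, as determined by the current state and the scanned symbol; the step that enters HALT is counted. The machine *computes* the number $v$ if, started on the empty (all blank) tape, it runs for more than $v$ steps and then halts, with $v$ shown in unary on its final tape: somewhere on the tape there are exactly $v+1$ consecutive copies of a stroke, neither preceded nor followed by a further copy, where a stroke is some fixed word of tape symbols, not all of them blank (a single symbol, or the code word of a symbol). **Theorem.** For each of the following sizes there is a Turing machine of that size that computes $n(3)$, respectively $n(4)$; in particular it halts on the empty tape after more than $n(3)$, respectively $n(4)$, steps. * For $n(3)$: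 $\mathrm{TM}(2,1840)$, $\mathrm{TM}(3,1080)$, $\mathrm{TM}(9,800)$, $\mathrm{TM}(44,8)$, $\mathrm{TM}(54,7)$, $\mathrm{TM}(155,3)$ and $\mathrm{TM}(276,2)$. * For $n(4)$: $\mathrm{TM}(2,2450)$, $\mathrm{TM}(3,1440)$, $\mathrm{TM}(9,1030)$, $\mathrm{TM}(47,10)$, $\mathrm{TM}(58,9)$, $\mathrm{TM}(160,4)$, $\mathrm{TM}(353,3)$ and $\mathrm{TM}(922,2)$. -/

import Mathlib

/-! ### Long finite sequences -/

namespace Friedman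

/-- For a word `s = s₁ s₂ ⋯` and `1 ≤ i`, the word `s⁽ⁱ⁾ = sᵢ sᵢ₊₁ ⋯ s₂ᵢ` of length `i + 1`
(for `2 * i ≤ s.length`). -/
def block {α : Type*} (s : List α) (i : ℕ) : List α :=
  (s.drop (i - 1)).take (i + 1)

/-- Property `(*)`: there are no `1 ≤ i < j ≤ s.length / 2` such that `s⁽ⁱ⁾` is a subword of `s⁽ʲ⁾`.
A subword is a not necessarily contiguous one, which is `List.Sublist`. -/
def Star {α : Type*} (s : List α) : Prop :=
  ∀ i j : ℕ, 1 ≤ i → i < j → 2 * j ≤ s.length → ¬ (block s i).Sublist (block s j)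

/-- The lengths of the words with property `(*)` over an alphabet of `k` letters. -/
def starLengths (k : ℕ) : Set ℕ :=
  {N | ∃ s : List (Fin k), s.length = N ∧ Star s}

/-- `n(k)`, the length of a longest word with property `(*)` over an alphabet of `k` letters. The
maximum exists, see `isGreatest_longest`. -/
noncomputable def longest (k : ℕ) : ℕ := sSup (starLengths k)

theorem block_congr {α : Type*} {s t : List α} {i : ℕ} (hi : 1 ≤ i) (hs : 2 * i ≤ s.length)
    (ht : 2 * i ≤ t.length) (h : ∀ m (h₁ : m < s.length) (h₂ : m < t.length), m < 2 * i →
      s[m] = t[m]) : block s i = block t i := by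
  unfold block
  apply List.ext_getElem
  · simp; omega
  · intro m h₁ h₂
    simp only [List.length_take, List.length_drop] at h₁ h₂
    simp only [List.getElem_take, List.getElem_drop]
    apply h
    omega

theorem bddAbove_starLengths (k : ℕ) : BddAbove (starLengths k) := by
  by_contra hb
  rw [not_bddAbove_iff] at hb
  let C : ℕ → Set (ℕ → Fin k) := fun n => {f | Star (List.ofFn fun i : Fin n => f i)}
  have hanti : ∀ n, C (n + 1) ⊆ C n := by
    intro n f hf i j hi hij hj hsub
    simp only [List.length_ofFn] at hj
    refine hf i j hi hij (by simp; omega) ?_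
    rw [block_congr (t := List.ofFn fun i : Fin n => f i) hi (by simp; omega) (by simp; omega)
      (by intros; simp only [List.getElem_ofFn]), block_congr (i := j) (t := List.ofFn fun i : Fin n => f i) (by omega)
      (by simp; omega) (by simp; omega) (by intros; simp only [List.getElem_ofFn])]
    exact hsub
  have hne : ∀ n, (C n).Nonempty := by
    intro n
    obtain ⟨N, ⟨s, hs, hstar⟩, hN⟩ := hb n
    have hpos : 0 < s.length := by omega
    refine ⟨fun i => s.getD i s[0], ?_⟩
    intro i j hi hij hj hsub
    simp only [List.length_ofFn] at hj
    refine hstar i j hi hij (by omega) ?_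
    rw [block_congr (t := List.ofFn fun i : Fin n => s.getD i s[0]) hi (by omega) (by simp; omega)
      (by intro m h₁ h₂ _; simp [h₁]),
      block_congr (i := j) (t := List.ofFn fun i : Fin n => s.getD i s[0]) (by omega)
      (by omega) (by simp; omega) (by intro m h₁ h₂ _; simp [h₁])]
    exact hsub
  have hclosed : ∀ n, IsClosed (C n) := by
    intro n
    have hc : Continuous fun (f : ℕ → Fin k) (i : Fin n) => f i := by fun_prop
    exact (isClosed_discrete {g : Fin n → Fin k | Star (List.ofFn g)}).preimage hc
  obtain ⟨f, hf⟩ := IsCompact.nonempty_iInter_of_sequence_nonempty_isCompact_isClosed C hanti hne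
    (hclosed 0).isCompact hclosed
  rw [Set.mem_iInter] at hf
  have hfin : (Set.univ : Set (Fin k)).PartiallyWellOrderedOn Eq :=
    Set.finite_univ.partiallyWellOrderedOn
  have hig := hfin.partiallyWellOrderedOn_sublistForall₂ Eq
  let g : ℕ → List (Fin k) := fun i => block (List.ofFn fun m : Fin (2 * (i + 1)) => f m) (i + 1)
  obtain ⟨i, j, hij, hsub⟩ := hig.exists_lt (f := g) (by simp)
  rw [List.sublistForall₂_iff] at hsub
  obtain ⟨l, hl, hsub⟩ := hsub
  rw [List.forall₂_eq_eq_eq] at hl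
  subst hl
  refine hf (2 * (j + 1)) (i + 1) (j + 1) (by omega) (by omega) (by rw [List.length_ofFn]) ?_
  rw [block_congr (t := List.ofFn fun m : Fin (2 * (i + 1)) => f m) (by omega)
    (by rw [List.length_ofFn]; omega) (by rw [List.length_ofFn])
    (by intros; simp only [List.getElem_ofFn])]
  exact hsub

theorem isGreatest_longest (k : ℕ) : IsGreatest (starLengths k) (longest k) :=
  have hne : (starLengths k).Nonempty := ⟨0, [], rfl, fun i j _ _ h => by simp at h; omega⟩
  ⟨Nat.sSup_mem hne (bddAbove_starLengths k), fun _ h => le_csSup (bddAbove_starLengths k) h⟩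

end Friedman

/-! ### Turing machines -/

/-- A Turing machine with `n` states and `m` tape symbols, one of them the blank. In state `q`,
scanning the symbol `e`, it writes the symbol `write q e`, moves its head one cell in the direction
`move q e`, and enters the state `next q e`, where `none` stands for HALT (which is not counted as
one of the `n` states). -/
structure TM (n m : ℕ) where
  start : Fin n
  blank : Fin m
  next : Fin n → Fin m → Option (Fin n)
  write : Fin n → Fin m → Fin m
  move : Fin n → Fin m → Turing.Dir

namespace TM

/-- A configuration: the state (`none` after halting), the head position, and the content of the
tape, which is infinite in both directions. -/
structure Config (n m : ℕ) where
  state : Option (Fin n)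
  head : ℤ
  tape : ℤ → Fin m

/-- The displacement of the head. -/
def shift : Turing.Dir → ℤ
  | Turing.Dir.left => -1
  | Turing.Dir.right => 1

/-- One step of the machine; a halted configuration stays as it is. -/
def step {n m : ℕ} (M : TM n m) (c : Config n m) : Config n m :=
  match c.state with
  | none => c
  | some q =>
    { state := M.next q (c.tape c.head)
      head := c.head + shift (M.move q (c.tape c.head))
      tape := Function.update c.tape c.head (M.write q (c.tape c.head)) }

/-- The start state on an empty tape. -/
def init {n m : ℕ} (M : TM n m) : Config n m :=
  { state := some M.start, head := 0, tape := fun _ => M.blank }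

/-- The configuration after `t` steps from the empty tape. -/
def run {n m : ℕ} (M : TM n m) (t : ℕ) : Config n m := M.step^[t] M.init

/-- Started on an empty tape, the machine makes exactly `T` steps and then has halted. The step
that enters HALT is counted. -/
def HaltsAfter {n m : ℕ} (M : TM n m) (T : ℕ) : Prop :=
  (M.run T).state = none ∧ ∀ t < T, (M.run t).state ≠ none

/-- The word `w` stands on the tape, from cell `p` on rightwards. -/
def Reads {m l : ℕ} (tape : ℤ → Fin m) (p : ℤ) (w : Fin l → Fin m) : Prop :=
  ∀ i : Fin l, tape (p + (i : ℕ)) = w i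

/-- The tape shows the number `v` in unary, by `v + 1` strokes: somewhere on the tape there is a
sequence of exactly `v + 1` consecutive copies of a stroke `w`, neither preceded nor followed by a
further copy. The stroke is a fixed word, not entirely blank, of some length `l ≥ 1` (which is `1`
when strokes are single symbols, and larger when symbols are coded by words over a smaller
alphabet). -/
def ShowsUnary {m : ℕ} (blank : Fin m) (tape : ℤ → Fin m) (v : ℕ) : Prop :=
  ∃ (l : ℕ) (w : Fin l → Fin m) (p : ℤ), (∃ i, w i ≠ blank) ∧
    (∀ j : ℕ, j ≤ v → Reads tape (p + l * j) w) ∧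
    ¬ Reads tape (p - l) w ∧ ¬ Reads tape (p + l * (v + 1)) w

/-- Started on an empty tape, the machine runs for more than `v` steps and then halts, with `v`
shown in unary on its tape. -/
def Computes {n m : ℕ} (M : TM n m) (v : ℕ) : Prop :=
  ∃ T : ℕ, v < T ∧ M.HaltsAfter T ∧ ShowsUnary M.blank (M.run T).tape v

/-- There is a machine with `n` states and `m` symbols that computes `v`. -/
def ExistsOfSize (n m v : ℕ) : Prop := ∃ M : TM n m, M.Computes v

end TM

/-!
A machine computes `n(k)` by going through all words of length `1`, then of length `2`, and so on,
in lexicographic order, and testing each for property `(*)`: a word that has it is extended by a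
zero, a word that does not is replaced by its successor. No word before the extension has the
property, since a prefix of a word with property `(*)` has it too. Hence the counter runs through
to its last word, leaving only zeros behind, exactly when the words have length `n(k) + 1`, and
these zeros are the strokes. The blocks `s⁽ⁱ⁾` and `s⁽ʲ⁾` under comparison are marked on the
letters, and matching the pattern greedily from the left decides whether it is a subword of the
text.

The sizes come from coding this machine. If a symbol takes two cells, one for the letter and one for
the marks, and the same symbols are used for both, then few symbols suffice. If the letter and the
marks are coded by three bits each, then two suffice. In either case it is a finite computation
that the window of one symbol is rewritten as it should be. Two states suffice by a construction of
Shannon: the state is a counter on the tape, and the head, going to and fro between two neighbouring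
cells, passes the counter on unit by unit.
-/

/-! ### Machines over arbitrary types and their simulation -/

/-- A Turing machine whose states and tape symbols are taken from arbitrary types: `trans q e` is
the next state (`none` for HALT), the symbol written, and the direction of the move. -/
structure Mach (Q S : Type*) where
  start : Q
  blank : S
  trans : Q → S → Option Q × S × Turing.Dir

namespace Mach

variable {Q S Q' S' : Type*}

/-- A configuration of a machine, encoded as in `TM.Config`. -/
@[ext] structure Cfg (Q S : Type*) where
  state : Option Q
  head : ℤ
  tape : ℤ → S

/-- One step of the machine; a halted configuration stays as it is. -/
def step (M : Mach Q S) (c : Cfg Q S) : Cfg Q S :=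
  match c.state with
  | none => c
  | some q =>
    { state := (M.trans q (c.tape c.head)).1
      head := c.head + TM.shift (M.trans q (c.tape c.head)).2.2
      tape := Function.update c.tape c.head (M.trans q (c.tape c.head)).2.1 }

/-- The start state on an empty tape. -/
def init (M : Mach Q S) : Cfg Q S := ⟨some M.start, 0, fun _ => M.blank⟩

/-- Reachability in any finite number of steps, zero included. -/
def Reaches (M : Mach Q S) (c c' : Cfg Q S) : Prop := ∃ t, M.step^[t] c = c'

/-- The word `w` stands on the tape, from cell `p` on rightwards; as `TM.Reads`. -/
def Reads {l : ℕ} (tape : ℤ → S) (p : ℤ) (w : Fin l → S) : Prop :=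
  ∀ i : Fin l, tape (p + (i : ℕ)) = w i

/-- The tape shows `v` by `v + 1` strokes; as `TM.ShowsUnary`. -/
def ShowsUnary (blank : S) (tape : ℤ → S) (v : ℕ) : Prop :=
  ∃ (l : ℕ) (w : Fin l → S) (p : ℤ), (∃ i, w i ≠ blank) ∧
    (∀ j : ℕ, j ≤ v → Reads tape (p + l * j) w) ∧
    ¬ Reads tape (p - l) w ∧ ¬ Reads tape (p + l * (v + 1)) w

/-- The machine halts on the empty tape and then shows `v`. Unlike in `TM.Computes`, there is no
bound on the time: a machine needs more than `v` steps to write `v + 1` strokes. -/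
def Outputs (M : Mach Q S) (v : ℕ) : Prop :=
  ∃ (h : ℤ) (tape : ℤ → S), M.Reaches M.init ⟨none, h, tape⟩ ∧ ShowsUnary M.blank tape v

section Reaches

theorem Reaches.refl (M : Mach Q S) (c : Cfg Q S) : M.Reaches c c := ⟨0, rfl⟩

theorem Reaches.trans {M : Mach Q S} {a b c : Cfg Q S} (h : M.Reaches a b) (h' : M.Reaches b c) :
    M.Reaches a c := by
  obtain ⟨s, rfl⟩ := h
  obtain ⟨t, rfl⟩ := h'
  exact ⟨t + s, Function.iterate_add_apply _ _ _ _⟩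

theorem reaches_step (M : Mach Q S) {q : Q} {h : ℤ} {tape tape' : ℤ → S} {q' : Option Q} {e : S}
    {d : Turing.Dir} (ht : M.trans q (tape h) = (q', e, d))
    (ht' : tape' = Function.update tape h e) :
    M.Reaches ⟨some q, h, tape⟩ ⟨q', h + TM.shift d, tape'⟩ :=
  ⟨1, by simp [step, ht, ht']⟩

theorem reaches_sweep (M : Mach Q S) {q : Q} {d : Turing.Dir} {x : ℤ} {n : ℕ} {tape tape' : ℤ → S}
    (hin : ∀ i < n, M.trans q (tape (x + TM.shift d * i)) =
      (some q, tape' (x + TM.shift d * i), d))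
    (hout : ∀ z, (∀ i < n, z ≠ x + TM.shift d * i) → tape' z = tape z) :
    M.Reaches ⟨some q, x, tape⟩ ⟨some q, x + TM.shift d * n, tape'⟩ := by
  induction n generalizing x tape with
  | zero =>
    obtain rfl : tape' = tape := funext fun z => hout z (by simp)
    simpa using Reaches.refl M _
  | succ n ih =>
    have hd : TM.shift d ≠ 0 := by cases d <;> decide
    have hfirst := M.reaches_step (by simpa using hin 0 n.succ_pos) rfl
    have hnext (i : ℕ) : x + TM.shift d + TM.shift d * i = x + TM.shift d * (i + 1 : ℕ) := by
      push_cast; ring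
    have hrest := ih (x := x + TM.shift d) (tape := Function.update tape x (tape' x))
      (fun i hi => by
        rw [hnext, Function.update_of_ne (by simp [hd]; omega)]
        exact hin (i + 1) (by omega))
      (fun z hz => by
        rcases eq_or_ne z x with rfl | hne
        · simp
        · rw [Function.update_of_ne hne]
          refine hout z fun i hi => ?_
          rcases i with _ | i
          · simpa using hne
          · rw [← hnext]
            exact hz i (by omega))
    rw [hnext] at hrest
    exact hfirst.trans hrest

theorem reaches_sweep_right (M : Mach Q S) {q : Q} {x y : ℤ} {tape tape' : ℤ → S} (hxy : x ≤ y)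
    (hin : ∀ z, x ≤ z → z < y → M.trans q (tape z) = (some q, tape' z, Turing.Dir.right))
    (hout : ∀ z, (z < x ∨ y ≤ z) → tape' z = tape z) :
    M.Reaches ⟨some q, x, tape⟩ ⟨some q, y, tape'⟩ := by
  obtain ⟨n, rfl⟩ := Int.le.dest hxy
  convert M.reaches_sweep (d := .right) (x := x) (n := n) (tape := tape) (tape' := tape')
    (fun i hi => ?_) (fun z hz => ?_) using 2
  · simp [TM.shift]
  · exact hin _ (by simp [TM.shift]) (by simpa [TM.shift])
  · exact hout z (by_contra fun h => hz (z - x).toNat (by omega) (by simp only [TM.shift]; omega))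

theorem reaches_sweep_left (M : Mach Q S) {q : Q} {x y : ℤ} {tape tape' : ℤ → S} (hyx : y ≤ x)
    (hin : ∀ z, y < z → z ≤ x → M.trans q (tape z) = (some q, tape' z, Turing.Dir.left))
    (hout : ∀ z, (z ≤ y ∨ x < z) → tape' z = tape z) :
    M.Reaches ⟨some q, x, tape⟩ ⟨some q, y, tape'⟩ := by
  obtain ⟨n, rfl⟩ := Int.le.dest hyx
  convert M.reaches_sweep (d := .left) (x := y + n) (n := n) (tape := tape) (tape' := tape')
    (fun i hi => ?_) (fun z hz => ?_) using 2
  · simp [TM.shift]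
  · exact hin _ (by simp [TM.shift]; omega) (by simp [TM.shift])
  · exact hout z (by_contra fun h =>
      hz (y + n - z).toNat (by omega) (by simp only [TM.shift]; omega))

end Reaches

section Simulation

theorem Outputs.of_simulation {M : Mach Q S} {M' : Mach Q' S'} {v : ℕ}
    (R : Cfg Q S → Cfg Q' S' → Prop) (hinit : ∃ c', M'.Reaches M'.init c' ∧ R M.init c')
    (hstep : ∀ c c', R c c' → ∃ c'', M'.Reaches c' c'' ∧ R (M.step c) c'')
    (hhalt : ∀ c c', R c c' → c.state = none → c'.state = none)
    (hshows : ∀ c c', R c c' → c.state = none → ShowsUnary M.blank c.tape v →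
      ShowsUnary M'.blank c'.tape v)
    (hM : M.Outputs v) : M'.Outputs v := by
  have hiterate (t : ℕ) : ∃ c', M'.Reaches M'.init c' ∧ R (M.step^[t] M.init) c' := by
    induction t with
    | zero => exact hinit
    | succ t ih =>
      obtain ⟨c', hreach, hR⟩ := ih
      obtain ⟨c'', hreach', hR'⟩ := hstep _ _ hR
      rw [Function.iterate_succ_apply']
      exact ⟨c'', hreach.trans hreach', hR'⟩
  obtain ⟨h, tape, ⟨t, ht⟩, hv⟩ := hM
  obtain ⟨⟨state', h', tape'⟩, hreach, hR⟩ := hiterate t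
  rw [ht] at hR
  obtain rfl : state' = none := hhalt _ _ hR rfl
  exact ⟨h', tape', hreach, hshows _ _ hR rfl hv⟩

theorem divNat_finProdFinEquiv {m n : ℕ} (x : Fin m × Fin n) :
    (finProdFinEquiv x).divNat = x.1 :=
  congrArg Prod.fst (finProdFinEquiv.symm_apply_apply x)

theorem modNat_finProdFinEquiv {m n : ℕ} (x : Fin m × Fin n) :
    (finProdFinEquiv x).modNat = x.2 :=
  congrArg Prod.snd (finProdFinEquiv.symm_apply_apply x)

theorem ShowsUnary.of_code {l : ℕ} {code : S → Fin (l + 1) → S'} (hcode : Function.Injective code)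
    {blank : S} {blank' : S'} (hblank : code blank = fun _ => blank') {tape : ℤ → S}
    {tape' : ℤ → S'} {o : ℤ} (htape : ∀ z, Reads tape' (o + (l + 1) * z) (code (tape z))) {v : ℕ}
    (h : ShowsUnary blank tape v) : ShowsUnary blank' tape' v := by
  obtain ⟨k, w, p, ⟨i, hi⟩, hstrokes, hbefore, hafter⟩ := h
  have hreads (x : ℤ) : Reads tape' (o + (l + 1) * x)
      (fun y : Fin (k * (l + 1)) => code (w y.divNat) y.modNat) ↔ Reads tape x w := by
    have hcell (a : Fin k) (b : Fin (l + 1)) :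
        tape' (o + (l + 1) * x + (finProdFinEquiv (a, b) : ℕ)) = code (tape (x + (a : ℕ))) b := by
      rw [← htape]
      congr 1
      simp only [finProdFinEquiv_apply_val]
      push_cast
      ring
    simp only [Reads, finProdFinEquiv.surjective.forall, Prod.forall, hcell,
      divNat_finProdFinEquiv, modNat_finProdFinEquiv]
    exact forall_congr' fun a => by rw [← funext_iff, hcode.eq_iff]
  have hi' : code (w i) ≠ fun _ => blank' := fun h => hi (hcode (h.trans hblank.symm))
  obtain ⟨b, hb⟩ := Function.ne_iff.1 hi'
  refine ⟨k * (l + 1), fun y => code (w y.divNat) y.modNat, o + (l + 1) * p,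
    ⟨finProdFinEquiv (i, b), ?_⟩, fun j hj => ?_, ?_, ?_⟩
  · simpa only [divNat_finProdFinEquiv, modNat_finProdFinEquiv] using hb
  · convert (hreads _).2 (hstrokes j hj) using 1; push_cast; ring
  · convert mt (hreads _).1 hbefore using 2; push_cast; ring
  · convert mt (hreads _).1 hafter using 2; push_cast; ring

theorem ShowsUnary.of_injective {f : S → S'} (hf : Function.Injective f) {blank : S}
    {tape : ℤ → S} {tape' : ℤ → S'} {o : ℤ} (htape : ∀ z, tape' (o + z) = f (tape z)) {v : ℕ}
    (h : ShowsUnary blank tape v) : ShowsUnary (f blank) tape' v :=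
  h.of_code (code := fun e (_ : Fin 1) => f e) (fun _ _ hab => hf (congrFun hab 0)) rfl
    (o := o) fun z i => by simpa using htape z

end Simulation

section Coding

/-- The cell of a window of `l` cells next to the cell `i`, or `none` outside the window. -/
def neighbor {l : ℕ} (i : Fin l) : Turing.Dir → Option (Fin l)
  | .left => if (i : ℕ) = 0 then none else some ⟨i - 1, by omega⟩
  | .right => if h : (i : ℕ) + 1 < l then some ⟨i + 1, h⟩ else none

/-- Run `M` for at most `fuel` steps, from the state `q`, on a window that holds the word `w`, with
the head on its cell `i`, until the machine halts or leaves the window: the state then entered, the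
direction of the last move, and the word left behind. The result is `none` when the fuel does not
suffice. -/
def localRun {l : ℕ} (M : Mach Q S) (fuel : ℕ) (q : Q) (i : Fin l) (w : Fin l → S) :
    Option (Option Q × Turing.Dir × (Fin l → S)) :=
  match fuel with
  | 0 => none
  | fuel + 1 =>
    match M.trans q (w i) with
    | (none, e, d) => some (none, d, Function.update w i e)
    | (some q', e, d) =>
      match neighbor i d with
      | none => some (some q', d, Function.update w i e)
      | some j => M.localRun fuel q' j (Function.update w i e)

theorem add_shift_of_neighbor_eq_some {l : ℕ} {i j : Fin l} {d : Turing.Dir}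
    (h : neighbor i d = some j) : (i : ℤ) + TM.shift d = j := by
  cases d <;> simp only [neighbor, Option.ite_none_left_eq_some, Option.dite_none_right_eq_some,
    Option.some.injEq] at h <;> obtain ⟨hi, rfl⟩ := h <;> simp [TM.shift]
  omega

/-- The cell on which a head that moves in the direction `d` enters a window of `l + 1` cells. -/
def entrance {l : ℕ} : Turing.Dir → Fin (l + 1)
  | .left => Fin.last l
  | .right => 0

theorem add_shift_of_neighbor_eq_none {l : ℕ} {i : Fin (l + 1)} {d : Turing.Dir}
    (h : neighbor i d = none) :
    (i : ℤ) + TM.shift d = (l + 1) * TM.shift d + (entrance (l := l) d : ℕ) := by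
  cases d
  · simp only [neighbor, ite_eq_left_iff, reduceCtorEq, imp_false, Decidable.not_not] at h
    simp only [h, TM.shift, entrance, Fin.val_last]
    omega
  · simp only [neighbor, dite_eq_right_iff, reduceCtorEq, imp_false, not_lt] at h
    simp only [TM.shift, entrance, Fin.val_zero]
    omega

theorem Reads.update {l : ℕ} {tape : ℤ → S} {p : ℤ} {w : Fin l → S} (h : Reads tape p w)
    (i : Fin l) (e : S) :
    Reads (Function.update tape (p + (i : ℕ)) e) p (Function.update w i e) := by
  intro j
  rcases eq_or_ne j i with rfl | hne
  · simp
  · rw [Function.update_of_ne hne, Function.update_of_ne (by simpa [Fin.val_inj]), h]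

theorem reaches_of_localRun {l : ℕ} (M : Mach Q S) {fuel : ℕ} {q : Q} {i : Fin (l + 1)}
    {w w' : Fin (l + 1) → S} {r : Option Q} {d : Turing.Dir}
    (hrun : M.localRun fuel q i w = some (r, d, w')) {p : ℤ} {tape : ℤ → S} (hw : Reads tape p w) :
    ∃ h tape', M.Reaches ⟨some q, p + (i : ℕ), tape⟩ ⟨r, h, tape'⟩ ∧
      (r ≠ none → h = p + (l + 1) * TM.shift d + (entrance (l := l) d : ℕ)) ∧
      Reads tape' p w' ∧ ∀ z, (∀ j : Fin (l + 1), z ≠ p + (j : ℕ)) → tape' z = tape z := by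
  induction fuel generalizing q i w tape with
  | zero => simp [localRun] at hrun
  | succ fuel ih =>
    rcases htrans : M.trans q (w i) with ⟨r₁, e, d₁⟩
    have hfirst := M.reaches_step ((congrArg _ (hw i)).trans htrans) rfl
    have hupdate := hw.update i e
    have houtside (z : ℤ) (hz : ∀ j : Fin (l + 1), z ≠ p + (j : ℕ)) :
        Function.update tape (p + (i : ℕ)) e z = tape z := Function.update_of_ne (hz i) _ _
    rw [localRun, htrans] at hrun
    rcases r₁ with _ | q₁
    · simp only [Option.some.injEq, Prod.mk.injEq] at hrun
      obtain ⟨rfl, rfl, rfl⟩ := hrun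
      exact ⟨_, _, hfirst, by simp, hupdate, houtside⟩
    · rcases hneighbor : neighbor i d₁ with _ | j
      · simp only [hneighbor, Option.some.injEq, Prod.mk.injEq] at hrun
        obtain ⟨rfl, rfl, rfl⟩ := hrun
        refine ⟨_, _, hfirst, fun _ => ?_, hupdate, houtside⟩
        rw [add_assoc, add_assoc, add_shift_of_neighbor_eq_none hneighbor]
      · simp only [hneighbor] at hrun
        rw [add_assoc, add_shift_of_neighbor_eq_some hneighbor] at hfirst
        obtain ⟨h, tape', hreach, hhead, hw', hrest⟩ := ih hrun hupdate
        exact ⟨h, tape', hfirst.trans hreach, hhead, hw',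
          fun z hz => (hrest z hz).trans (houtside z hz)⟩

/-- Run on the code word of `e`, entered in the direction `enter q` in the state `σ q`, the machine
`M'` does what `M` does on `e` in the state `q`. -/
def CodesStep {l : ℕ} (M : Mach Q S) (M' : Mach Q' S') (σ : Q → Q') (enter : Q → Turing.Dir)
    (code : S → Fin (l + 1) → S') (fuel : ℕ) (q : Q) (e : S) : Prop :=
  M'.localRun fuel (σ q) (entrance (enter q)) (code e) =
      some ((M.trans q e).1.map σ, (M.trans q e).2.2, code (M.trans q e).2.1) ∧
    ∀ q' ∈ (M.trans q e).1, enter q' = (M.trans q e).2.2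

instance {l : ℕ} [DecidableEq Q'] [DecidableEq S'] (M : Mach Q S) (M' : Mach Q' S') (σ : Q → Q')
    (enter : Q → Turing.Dir) (code : S → Fin (l + 1) → S') (fuel : ℕ) (q : Q) (e : S) :
    Decidable (M.CodesStep M' σ enter code fuel q e) :=
  inferInstanceAs (Decidable (_ ∧ _))

/-- The configuration `c'` codes `c`, symbol by symbol, from the cell `o` on. -/
structure CodesCfg {l : ℕ} (σ : Q → Q') (enter : Q → Turing.Dir) (code : S → Fin (l + 1) → S')
    (o : ℤ) (c : Cfg Q S) (c' : Cfg Q' S') : Prop where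
  state_eq : c'.state = c.state.map σ
  head_eq : ∀ q ∈ c.state, c'.head = o + (l + 1) * c.head + (entrance (l := l) (enter q) : ℕ)
  reads : ∀ z, Reads c'.tape (o + (l + 1) * z) (code (c.tape z))

variable {l : ℕ} {M : Mach Q S} {M' : Mach Q' S'} {σ : Q → Q'} {enter : Q → Turing.Dir}
  {code : S → Fin (l + 1) → S'} {fuel : ℕ} {o : ℤ}

theorem eq_of_mem_windows {x y : ℤ} (i j : Fin (l + 1))
    (h : o + (l + 1) * x + (i : ℕ) = o + (l + 1) * y + (j : ℕ)) : x = y := by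
  nlinarith [i.2, j.2]

theorem CodesCfg.exists_step (hstep : ∀ q e, M.CodesStep M' σ enter code fuel q e) {c : Cfg Q S}
    {c' : Cfg Q' S'} (hc : CodesCfg σ enter code o c c') :
    ∃ c'', M'.Reaches c' c'' ∧ CodesCfg σ enter code o (M.step c) c'' := by
  obtain ⟨_ | q, h, tape⟩ := c
  · exact ⟨c', .refl _ _, hc⟩
  obtain ⟨state', h', tape'⟩ := c'
  obtain ⟨rfl, hhead, hreads⟩ := hc
  obtain rfl := hhead q rfl
  obtain ⟨hrun, henter⟩ := hstep q (tape h)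
  obtain ⟨h', tape'', hreach, hexit, hwritten, hrest⟩ := M'.reaches_of_localRun hrun (hreads h)
  refine ⟨_, hreach, rfl, fun q' hq' => ?_, fun z => ?_⟩
  · rw [henter q' hq', hexit (Option.ne_none_iff_exists'.2 ⟨σ q', congrArg (Option.map σ) hq'⟩)]
    simp only [step]
    ring
  · rcases eq_or_ne z h with rfl | hne
    · simpa [step] using hwritten
    · intro i
      simp only [step, Function.update_of_ne hne]
      rw [hrest _ fun j hj => hne (eq_of_mem_windows i j hj), hreads z i]

theorem Outputs.of_codesStep (hstart : M'.start = σ M.start) (hcode : Function.Injective code)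
    (hblank : code M.blank = fun _ => M'.blank)
    (hstep : ∀ q e, M.CodesStep M' σ enter code fuel q e) {v : ℕ} (hM : M.Outputs v) :
    M'.Outputs v := by
  refine hM.of_simulation (CodesCfg σ enter code (-(entrance (l := l) (enter M.start) : ℕ)))
    ⟨_, .refl _ _, by simp [init, hstart], ?_, fun z i => ?_⟩ (fun _ _ h => h.exists_step hstep)
    (fun c c' h hc => by simp [h.state_eq, hc]) (fun c c' h _ hv => hv.of_code hcode hblank h.reads)
  · simp [init]
  · simp [init, hblank]

end Coding

end Mach

namespace TM

variable {n m : ℕ}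

theorem iterate_step_of_state_eq_none (M : TM n m) {c : Config n m} (h : c.state = none) (t : ℕ) :
    M.step^[t] c = c :=
  Function.iterate_fixed (by simp [step, h]) t

theorem exists_finset_tape_eq_blank (M : TM n m) (t : ℕ) :
    ∃ s : Finset ℤ, s.card ≤ t ∧ ∀ z ∉ s, (M.run t).tape z = M.blank := by
  induction t with
  | zero => exact ⟨∅, by simp, fun z _ => rfl⟩
  | succ t ih =>
    obtain ⟨s, hs, h⟩ := ih
    refine ⟨insert (M.run t).head s, (Finset.card_insert_le _ _).trans (by omega), ?_⟩
    intro z hz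
    rw [Finset.mem_insert, not_or] at hz
    have hrun : M.run (t + 1) = M.step (M.run t) := Function.iterate_succ_apply' _ _ _
    rw [hrun, step]
    split
    · exact h z hz.2
    · simp [Function.update_of_ne hz.1, h z hz.2]

theorem lt_of_showsUnary (M : TM n m) {t v : ℕ} (h : ShowsUnary M.blank (M.run t).tape v) :
    v < t := by
  obtain ⟨l, w, p, ⟨i, hi⟩, hw, -, -⟩ := h
  obtain ⟨s, hs, hz⟩ := M.exists_finset_tape_eq_blank t
  have hmem : ∀ j ∈ Finset.range (v + 1), p + l * (j : ℕ) + (i : ℕ) ∈ s := by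
    intro j hj
    by_contra hn
    exact hi ((hw j (by simpa [Nat.lt_succ_iff] using hj) i).symm.trans (hz _ hn))
  have hinj : Set.InjOn (fun j : ℕ => p + l * (j : ℤ) + (i : ℕ)) (Finset.range (v + 1)) := by
    intro a _ b _ hab
    have hl : (l : ℤ) ≠ 0 := by have := i.2; omega
    have : (l : ℤ) * a = l * b := by simpa using hab
    exact_mod_cast mul_left_cancel₀ hl this
  have hcard := Finset.card_le_card_of_injOn _ hmem hinj
  rw [Finset.card_range] at hcard
  omega

theorem computes_of_showsUnary (M : TM n m) {t v : ℕ} (ht : (M.run t).state = none)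
    (h : ShowsUnary M.blank (M.run t).tape v) : M.Computes v := by
  classical
  have hex : ∃ t, (M.run t).state = none := ⟨t, ht⟩
  have hrun : M.run t = M.run (Nat.find hex) := by
    obtain ⟨s, rfl⟩ := Nat.exists_eq_add_of_le' (Nat.find_min' hex ht)
    rw [run, Function.iterate_add_apply]
    exact M.iterate_step_of_state_eq_none (Nat.find_spec hex) s
  rw [hrun] at h
  exact ⟨Nat.find hex, M.lt_of_showsUnary h, ⟨Nat.find_spec hex, fun _ h => Nat.find_min hex h⟩, h⟩

end TM

namespace Mach

variable {Q S : Type*}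

/-- A machine over the types of states and symbols used by `TM`, as a `TM`. -/
def toTM {n m : ℕ} (M : Mach (Fin n) (Fin m)) : TM n m where
  start := M.start
  blank := M.blank
  next q e := (M.trans q e).1
  write q e := (M.trans q e).2.1
  move q e := (M.trans q e).2.2

theorem Outputs.computes_toTM {n m : ℕ} {M : Mach (Fin n) (Fin m)} {v : ℕ} (h : M.Outputs v) :
    M.toTM.Computes v := by
  let toConfig (c : Cfg (Fin n) (Fin m)) : TM.Config n m := ⟨c.state, c.head, c.tape⟩
  have hstep : Function.Semiconj toConfig M.step M.toTM.step := by
    rintro ⟨_ | q, head, tape⟩ <;> rfl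
  obtain ⟨head, tape, ⟨t, ht⟩, hv⟩ := h
  have hrun : M.toTM.run t = toConfig ⟨none, head, tape⟩ := by
    rw [← ht, (hstep.iterate_right t).eq]
    rfl
  exact M.toTM.computes_of_showsUnary (t := t) (by rw [hrun]) (by rw [hrun]; exact hv)

theorem exists_leftInvOn_fin (A : Finset Q) (hA : A.Nonempty) {n : ℕ} (hn : A.card ≤ n) :
    ∃ (f : Q → Fin n) (g : Fin n → Q), Set.LeftInvOn g f A := by
  obtain ⟨q, -⟩ := id hA
  have : Nonempty Q := ⟨q⟩
  have : NeZero n := ⟨(hA.card_pos.trans_le hn).ne'⟩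
  obtain ⟨f, -, hf⟩ := A.finite_toSet.exists_injOn_of_encard_le (t := (Set.univ : Set (Fin n)))
    (by simpa using hn)
  exact ⟨f, Function.invFunOn f A, hf.leftInvOn_invFunOn⟩

/-- The copy of a machine along maps `f` and `i` of its states and symbols, with `g` and `j` in the
role of their inverses. -/
def transport {Q' S' : Type*} (M : Mach Q S) (f : Q → Q') (g : Q' → Q) (i : S → S') (j : S' → S) :
    Mach Q' S' where
  start := f M.start
  blank := i M.blank
  trans q e := ((M.trans (g q) (j e)).1.map f, i (M.trans (g q) (j e)).2.1,
    (M.trans (g q) (j e)).2.2)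

/-- The set `A` of states contains the start state and every state entered from a state in it. -/
def ClosedUnder (M : Mach Q S) (A : Finset Q) : Prop :=
  M.start ∈ A ∧ ∀ q ∈ A, ∀ e, ∀ q' ∈ (M.trans q e).1, q' ∈ A

theorem Outputs.transport {Q' S' : Type*} {M : Mach Q S} {v : ℕ} (h : M.Outputs v) {A : Finset Q}
    (hA : M.ClosedUnder A) {f : Q → Q'} {g : Q' → Q} (hfg : Set.LeftInvOn g f A) {i : S → S'}
    {j : S' → S} (hij : Function.LeftInverse j i) : (M.transport f g i j).Outputs v := by
  refine h.of_simulation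
    (fun c c' => c' = ⟨c.state.map f, c.head, i ∘ c.tape⟩ ∧ ∀ q ∈ c.state, q ∈ A)
    ⟨_, .refl _ _, rfl, fun q hq => Option.mem_some.1 hq ▸ hA.1⟩ ?_ ?_ ?_
  · rintro ⟨_ | q, head, tape⟩ _ ⟨rfl, hq⟩
    · exact ⟨_, .refl _ _, rfl, hq⟩
    · refine ⟨_, ⟨1, rfl⟩, ?_, hA.2 q (hq q rfl) _⟩
      simp [step, Mach.transport, hfg (hq q rfl), hij (tape head), Function.comp_update]
  · rintro c _ ⟨rfl, -⟩ hc
    simp [hc]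
  · rintro c _ ⟨rfl, -⟩ - hv
    exact hv.of_injective hij.injective (o := 0) fun z => by simp

theorem Outputs.existsOfSize [Fintype S] {M : Mach Q S} {v : ℕ} (h : M.Outputs v) {A : Finset Q}
    (hA : M.ClosedUnder A) {n m : ℕ} (hn : A.card ≤ n) (hm : Fintype.card S ≤ m) :
    TM.ExistsOfSize n m v := by
  obtain ⟨f, g, hfg⟩ := exists_leftInvOn_fin A ⟨_, hA.1⟩ hn
  obtain ⟨i, j, hij⟩ := exists_leftInvOn_fin Finset.univ ⟨M.blank, Finset.mem_univ _⟩ hm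
  exact ⟨_, (h.transport hA hfg fun e => hij (Finset.mem_univ e)).computes_toTM⟩

theorem Outputs.existsOfSize_of_card_le [Fintype Q] [Fintype S] {M : Mach Q S} {v : ℕ}
    (h : M.Outputs v) {n m : ℕ} (hn : Fintype.card Q ≤ n) (hm : Fintype.card S ≤ m) :
    TM.ExistsOfSize n m v :=
  h.existsOfSize (A := Finset.univ) ⟨Finset.mem_univ _, fun _ _ _ _ _ => Finset.mem_univ _⟩ hn hm

end Mach

/-! ### Simulation by two states -/

namespace Mach

/-- The opposite direction. -/
def opposite : Turing.Dir → Turing.Dir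
  | .left => .right
  | .right => .left

theorem add_shift_add_shift_opposite (x : ℤ) (d : Turing.Dir) :
    x + TM.shift d + TM.shift (opposite d) = x := by
  cases d <;> simp [opposite, TM.shift]

theorem add_shift_ne_self (x : ℤ) (d : Turing.Dir) : x + TM.shift d ≠ x := by
  cases d <;> simp [TM.shift]

end Mach

namespace TwoState

open Mach

/-- A counter stands for a state of the simulated machine, by the direction of the move that enters
the state and its number among the states that are entered in this direction. -/
abbrev Counter (r : ℕ) := Turing.Dir × Fin (r + 1)

/-- A symbol of the machine with two states: a symbol of the simulated machine, alone, or with a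
counter and a flag that tells the cell that the head leaves from the one that it enters. -/
abbrev Cell (S : Type*) (r : ℕ) := S ⊕ (Bool × Counter r × S)

variable {Q S : Type*} {r : ℕ}

instance : Fintype Turing.Dir := ⟨{.left, .right}, by rintro (_ | _) <;> simp⟩

/-- The cell that the head leaves. -/
abbrev sender (c : Counter r) (e : S) : Cell S r := .inr (true, c, e)

/-- The cell that the head enters. -/
abbrev receiver (c : Counter r) (e : S) : Cell S r := .inr (false, c, e)

/-- The state in which the head first enters a cell, from which the cell learns the direction. -/
def arrival : Turing.Dir → Bool
  | .right => false
  | .left => true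

/-- The transitions of the machine with two states. A counter is passed on from the sender to the
receiver one unit at a time, the head going to and fro between the two. In the receiver, the state
`false` brings one unit more, and `true` says that none is left. -/
def trans (M : Mach Q S) (enc : Q → Counter r) (dec : Counter r → Q) :
    Bool → Cell S r → Option Bool × Cell S r × Turing.Dir
  | false, .inl e => (some true, receiver (.right, 0) e, .left)
  | true, .inl e => (some false, receiver (.left, 0) e, .right)
  | _, .inr (true, (d, k), e) =>
    if (k : ℕ) = 0 then (some true, .inl e, d)
    else (some false, sender (d, ⟨k - 1, by omega⟩) e, d)
  | false, .inr (false, (d, k), e) =>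
    if h : (k : ℕ) < r then (some false, receiver (d, ⟨k + 1, by omega⟩) e, opposite d)
    else (some true, .inl e, opposite d)
  | true, .inr (false, c, e) =>
    match M.trans (dec c) e with
    | (none, e', d) => (none, .inl e', d)
    | (some q, e', d) => (some (arrival d), sender (enc q) e', d)

/-- The machine with two states that simulates `M`, with the counter `enc q` for the state `q`. -/
def machine (M : Mach Q S) (enc : Q → Counter r) (dec : Counter r → Q) : Mach Bool (Cell S r) where
  start := false
  blank := .inl M.blank
  trans := trans M enc dec

/-- The tape on which the cells `x` and `y` hold `s` and `t`, and the other cells no counters. -/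
def tapeWith (tape : ℤ → S) (x : ℤ) (s : Cell S r) (y : ℤ) (t : Cell S r) : ℤ → Cell S r :=
  Function.update (Function.update (Sum.inl ∘ tape) y t) x s

theorem tapeWith_comm (tape : ℤ → S) {x y : ℤ} (hxy : x ≠ y) (s t : Cell S r) :
    tapeWith tape x s y t = tapeWith tape y t x s :=
  Function.update_comm hxy.symm _ _ _

variable (M : Mach Q S) (enc : Q → Counter r) (dec : Counter r → Q) {tape : ℤ → S}

theorem reaches_step_fst {x y : ℤ} {s s' t : Cell S r} {q : Bool} {q' : Option Bool}
    {d : Turing.Dir} (h : trans M enc dec q s = (q', s', d)) :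
    (machine M enc dec).Reaches ⟨some q, x, tapeWith tape x s y t⟩
      ⟨q', x + TM.shift d, tapeWith tape x s' y t⟩ :=
  Mach.reaches_step _ (e := s') (by simpa [machine, tapeWith]) (by simp [tapeWith])

theorem reaches_step_snd {x y : ℤ} {s t t' : Cell S r} {q : Bool} {q' : Option Bool}
    {d : Turing.Dir} (hxy : x ≠ y) (h : trans M enc dec q t = (q', t', d)) :
    (machine M enc dec).Reaches ⟨some q, y, tapeWith tape x s y t⟩
      ⟨q', y + TM.shift d, tapeWith tape x s y t'⟩ := by
  rw [tapeWith_comm _ hxy, tapeWith_comm _ hxy]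
  exact reaches_step_fst M enc dec h

theorem reaches_transfer {x : ℤ} {d : Turing.Dir} {a b : S} (k : ℕ) {j : ℕ} (hk : k + j < r + 1)
    (q : Bool) :
    (machine M enc dec).Reaches
      ⟨some q, x, tapeWith tape x (sender (d, ⟨k, by omega⟩) a) (x + TM.shift d)
        (receiver (d, ⟨j, by omega⟩) b)⟩
      ⟨some true, x + TM.shift d, tapeWith tape x (.inl a) (x + TM.shift d)
        (receiver (d, ⟨k + j, hk⟩) b)⟩ := by
  induction k generalizing j q with
  | zero =>
    simp only [zero_add]
    exact reaches_step_fst M enc dec (by cases q <;> simp [trans])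
  | succ k ih =>
    have hsend := reaches_step_fst M enc dec (tape := tape) (x := x) (y := x + TM.shift d)
      (s := sender (d, ⟨k + 1, by omega⟩) a) (s' := sender (d, ⟨k, by omega⟩) a)
      (t := receiver (d, ⟨j, by omega⟩) b) (q := q) (q' := some false) (d := d)
      (by cases q <;> simp [trans])
    have hreceive := reaches_step_snd M enc dec (tape := tape) (x := x) (y := x + TM.shift d)
      (s := sender (d, ⟨k, by omega⟩) a) (t := receiver (d, ⟨j, by omega⟩) b)
      (t' := receiver (d, ⟨j + 1, by omega⟩) b) (q := false) (q' := some false) (d := opposite d)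
      (add_shift_ne_self x d).symm (by simp [trans, show j < r by omega])
    rw [add_shift_add_shift_opposite] at hreceive
    have hrest := ih (j := j + 1) (by omega) false
    simp only [← add_assoc, Nat.add_right_comm k j 1] at hrest
    exact (hsend.trans hreceive).trans hrest

theorem tapeWith_inl_left {x y : ℤ} (hxy : x ≠ y) (e : S) (t : Cell S r) :
    tapeWith tape x (.inl e) y t =
      Function.update (Sum.inl ∘ Function.update tape x e) y t := by
  rw [tapeWith_comm _ hxy, tapeWith, Function.comp_update]

theorem tapeWith_inl_right {x y : ℤ} (s : Cell S r) :
    tapeWith tape x s y (.inl (tape y)) = Function.update (Sum.inl ∘ tape) x s := by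
  rw [tapeWith, ← Function.comp_apply (f := Sum.inl) (g := tape), Function.update_eq_self]

/-- The tape on which the cell `x` has received the counter `c`. -/
def tapeAt (tape : ℤ → S) (x : ℤ) (c : Counter r) : ℤ → Cell S r :=
  Function.update (Sum.inl ∘ tape) x (receiver c (tape x))

theorem reaches_next {x : ℤ} {c : Counter r} {q : Q} {e : S} {d : Turing.Dir}
    (htrans : M.trans (dec c) (tape x) = (some q, e, d)) (hd : (enc q).1 = d) :
    (machine M enc dec).Reaches ⟨some true, x, tapeAt tape x c⟩
      ⟨some true, x + TM.shift d, tapeAt (Function.update tape x e) (x + TM.shift d) (enc q)⟩ := by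
  obtain ⟨k, hk⟩ : ∃ k, enc q = (d, k) := ⟨(enc q).2, Prod.ext hd rfl⟩
  have hne := add_shift_ne_self x d
  have hleave := reaches_step_fst M enc dec (tape := tape) (x := x) (y := x + TM.shift d)
    (s := receiver c (tape x)) (t := .inl (tape (x + TM.shift d))) (q := true)
    (s' := sender (d, k) e) (q' := some (arrival d)) (d := d) (by simp [trans, htrans, hk])
  have harrive := reaches_step_snd M enc dec (tape := tape) (x := x) (y := x + TM.shift d)
    (s := sender (d, k) e) (t := .inl (tape (x + TM.shift d))) (q := arrival d)
    (t' := receiver (d, 0) (tape (x + TM.shift d))) (q' := some (!arrival d)) (d := opposite d)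
    hne.symm (by cases d <;> rfl)
  rw [add_shift_add_shift_opposite] at harrive
  have htransfer := (hleave.trans harrive).trans
    (reaches_transfer M enc dec k (j := 0) k.2 (!arrival d))
  rw [tapeWith_inl_right, tapeWith_inl_left hne.symm] at htransfer
  simpa [tapeAt, hk, hne] using htransfer

theorem reaches_halt {x : ℤ} {c : Counter r} {e : S} {d : Turing.Dir}
    (htrans : M.trans (dec c) (tape x) = (none, e, d)) :
    (machine M enc dec).Reaches ⟨some true, x, tapeAt tape x c⟩
      ⟨none, x + TM.shift d, Sum.inl ∘ Function.update tape x e⟩ :=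
  Mach.reaches_step _ (e := .inl e) (by simp [machine, tapeAt, trans, htrans])
    (by simp [tapeAt, Function.comp_update])

-- Two receivers side by side bring units to each other, until one of them overflows.
theorem reaches_overflow {x : ℤ} {d : Turing.Dir} {a b : S} {k : ℕ} (hk : k < r + 1) :
    (machine M enc dec).Reaches
      ⟨some false, x, tapeWith tape x (receiver (opposite d, ⟨k, hk⟩) a) (x + TM.shift d)
        (receiver (d, ⟨k, hk⟩) b)⟩
      ⟨some true, x + TM.shift d, tapeWith tape x (.inl a) (x + TM.shift d)
        (receiver (d, Fin.last r) b)⟩ := by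
  have hopposite : opposite (opposite d) = d := by cases d <;> rfl
  induction h : r - k generalizing k with
  | zero =>
    obtain rfl : k = r := by omega
    exact reaches_step_fst M enc dec (by simp [trans, hopposite])
  | succ n ih =>
    have hfst := reaches_step_fst M enc dec (tape := tape) (x := x) (y := x + TM.shift d)
      (s := receiver (opposite d, ⟨k, hk⟩) a) (s' := receiver (opposite d, ⟨k + 1, by omega⟩) a)
      (t := receiver (d, ⟨k, hk⟩) b) (q := false) (q' := some false) (d := d)
      (by simp [trans, hopposite, show k < r by omega])
    have hsnd := reaches_step_snd M enc dec (tape := tape) (x := x) (y := x + TM.shift d)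
      (s := receiver (opposite d, ⟨k + 1, by omega⟩) a) (t := receiver (d, ⟨k, hk⟩) b)
      (t' := receiver (d, ⟨k + 1, by omega⟩) b) (q := false) (q' := some false) (d := opposite d)
      (add_shift_ne_self x d).symm (by simp [trans, show k < r by omega])
    rw [add_shift_add_shift_opposite] at hsnd
    exact (hfst.trans hsnd).trans (ih (by omega) (by omega))

theorem reaches_start : (machine M enc dec).Reaches (machine M enc dec).init
    ⟨some true, -1, tapeAt (fun _ => M.blank) (-1) (.left, Fin.last r)⟩ := by
  have hfst := reaches_step_fst M enc dec (tape := fun _ => M.blank) (x := 0) (y := -1)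
    (s := .inl M.blank) (t := .inl M.blank) (q := false) (q' := some true) (d := .left) rfl
  have hsnd := reaches_step_snd M enc dec (tape := fun _ => M.blank) (x := 0) (y := -1)
    (s := receiver (.right, 0) M.blank) (t := .inl M.blank) (q := true) (q' := some false)
    (d := .right) (by decide) rfl
  have hoverflow := (hfst.trans hsnd).trans
    (reaches_overflow M enc dec (x := 0) (d := .left) (Nat.succ_pos r))
  rw [tapeWith_inl_right, tapeWith_inl_left (by decide)] at hoverflow
  have hblank : Function.update (Sum.inl ∘ fun _ => M.blank) (0 : ℤ) (.inl M.blank) =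
      fun _ => (.inl M.blank : Cell S r) := Function.update_eq_self 0 _
  simpa [init, machine, tapeAt, TM.shift, hblank] using hoverflow

/-- The configuration `c'` of the machine with two states codes the configuration `c`. The start
has moved the head one cell to the left. -/
def CodesCfg (c : Cfg Q S) (c' : Cfg Bool (Cell S r)) : Prop :=
  match c.state with
  | none => c'.state = none ∧ c'.tape = Sum.inl ∘ c.tape ∘ (· + 1)
  | some q => c' = ⟨some true, c.head - 1, tapeAt (c.tape ∘ (· + 1)) (c.head - 1) (enc q)⟩

theorem CodesCfg.exists_step (hdec : Function.LeftInverse dec enc)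
    (hmove : ∀ q e, ∀ q' ∈ (M.trans q e).1, (enc q').1 = (M.trans q e).2.2) {c : Cfg Q S}
    {c' : Cfg Bool (Cell S r)} (hc : CodesCfg enc c c') :
    ∃ c'', (machine M enc dec).Reaches c' c'' ∧ CodesCfg enc (M.step c) c'' := by
  obtain ⟨_ | q, h, tape⟩ := c
  · exact ⟨c', .refl _ _, hc⟩
  obtain rfl := hc
  rcases htrans : M.trans q (tape h) with ⟨_ | q', e, d⟩
  all_goals
    have htrans' := htrans
    rw [← hdec q, show tape h = (tape ∘ (· + 1)) (h - 1) by simp] at htrans'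
    have hupdate : Function.update tape h e ∘ (· + 1) =
        Function.update (tape ∘ (· + 1)) (h - 1) e := by
      simpa using Function.update_comp_eq_of_injective tape (add_left_injective 1) (h - 1) e
  · refine ⟨_, reaches_halt M enc dec htrans', ?_⟩
    simp [CodesCfg, step, htrans, hupdate]
  · refine ⟨_, reaches_next M enc dec htrans' (by simpa [htrans] using hmove q (tape h)), ?_⟩
    simp [CodesCfg, step, htrans, hupdate, sub_add_eq_add_sub]

theorem outputs_machine (hdec : Function.LeftInverse dec enc)
    (hmove : ∀ q e, ∀ q' ∈ (M.trans q e).1, (enc q').1 = (M.trans q e).2.2)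
    (hstart : enc M.start = (.left, Fin.last r)) {v : ℕ} (hM : M.Outputs v) :
    (machine M enc dec).Outputs v := by
  refine hM.of_simulation (fun c c' => CodesCfg enc c c')
    ⟨_, reaches_start M enc dec, by simp [CodesCfg, init, hstart, Function.comp_def]⟩
    (fun c c' hc => hc.exists_step M enc dec hdec hmove) ?_ ?_
  · rintro ⟨_, head, tape⟩ c' hc rfl
    exact hc.1
  · rintro ⟨_, head, tape⟩ c' hc rfl hv
    exact hv.of_injective Sum.inl_injective (o := -1) fun z => by simp [hc.2]

theorem exists_counter [Fintype Q] (enter : Q → Turing.Dir)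
    (hr : ∀ d, (Finset.univ.filter (enter · = d)).card ≤ r + 1) {q₀ : Q} (hq₀ : enter q₀ = .left) :
    ∃ enc : Q → Counter r, Function.Injective enc ∧ (∀ q, (enc q).1 = enter q) ∧
      enc q₀ = (.left, Fin.last r) := by
  choose number hnumber using fun d =>
    {q | enter q = d}.toFinite.exists_injOn_of_encard_le (t := (Set.univ : Set (Fin (r + 1))))
      (by simpa [Set.encard_eq_coe_toFinset_card] using mod_cast hr d)
  let renumber := Equiv.swap (number .left q₀) (Fin.last r)
  refine ⟨fun q => (enter q, renumber (number (enter q) q)), fun q q' h => ?_, fun q => rfl, ?_⟩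
  · obtain ⟨hd, hk⟩ := Prod.mk.inj h
    rw [hd] at hk
    exact (hnumber _).2 hd rfl (renumber.injective hk)
  · simp [renumber, hq₀]

theorem existsOfSize [Fintype Q] [Fintype S] {M : Mach Q S} {v : ℕ} (h : M.Outputs v)
    {enter : Q → Turing.Dir} (hr : ∀ d, (Finset.univ.filter (enter · = d)).card ≤ r + 1)
    (hstart : enter M.start = .left)
    (hmove : ∀ q e, ∀ q' ∈ (M.trans q e).1, enter q' = (M.trans q e).2.2) {n m : ℕ}
    (hn : 2 ≤ n) (hm : Fintype.card S * (4 * r + 5) ≤ m) : TM.ExistsOfSize n m v := by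
  have : Nonempty Q := ⟨M.start⟩
  obtain ⟨enc, hinj, henter, hlast⟩ := exists_counter enter hr hstart
  have hcard : Fintype.card (Cell S r) = Fintype.card S * (4 * r + 5) := by
    have : Fintype.card Turing.Dir = 2 := rfl
    simp only [Fintype.card_sum, Fintype.card_prod, Fintype.card_bool, this, Fintype.card_fin]
    ring
  exact (outputs_machine M enc _ (Function.leftInverse_invFun hinj)
    (fun q e q' hq' => (henter q').trans (hmove q e q' hq')) hlast h).existsOfSize_of_card_le
    hn (hcard.trans_le hm)

end TwoState

/-! ### The search machine -/

namespace Searcher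

/-- The marks by which the search machine records, for the pattern as well as for the text, whether
a letter lies outside of it, or in it and is still to be matched, or in it and already matched. -/
inductive Mark
  | out
  | fresh
  | used
  deriving DecidableEq

instance : Fintype Mark := ⟨{.out, .fresh, .used}, by rintro (_ | _ | _) <;> simp⟩

/-- A tape symbol: the blank, or a letter with its mark in the pattern and its mark in the text. -/
abbrev Symbol (K : ℕ) := Option (Fin (K + 1) × Mark × Mark)

/-- The states of the search machine. `carry c` looks in the text for the letter `c` of the
pattern. A primed state follows the unprimed one when the first letter after the old end of the
block has been taken into it: a block grows by two letters when its beginning moves by one. -/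
inductive State (K : ℕ)
  | seek
  | carry (c : Fin (K + 1))
  | back
  | reset
  | moveText
  | growText
  | growText'
  | dropText
  | movePat
  | growPat
  | growPat'
  | clear
  | incr
  deriving DecidableEq, Fintype

/-- The mark with which a letter starts a new comparison. -/
def Mark.refresh : Mark → Mark
  | .out => .out
  | _ => .fresh

open Turing.Dir in
/-- The transitions of the search machine. -/
def trans {K : ℕ} : State K → Symbol K → Option (State K) × Symbol K × Turing.Dir
  | .seek, none => (some .incr, none, left)
  | .seek, some (l, .fresh, b) => (some (.carry l), some (l, .used, b), right)
  | .seek, e => (some .seek, e, right)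
  | .carry _, none => (some .reset, none, left)
  | .carry c, some (l, a, .fresh) =>
    if l = c then (some .back, some (l, a, .used), left)
    else (some (.carry c), some (l, a, .used), right)
  | .carry c, e => (some (.carry c), e, right)
  | .back, none => (some .seek, none, right)
  | .back, e => (some .back, e, left)
  | .reset, none => (some .moveText, none, right)
  | .reset, some (l, a, b) => (some .reset, some (l, a.refresh, b.refresh), left)
  | .moveText, none => (some .moveText, none, right)
  | .moveText, some (l, a, .out) => (some .moveText, some (l, a, .out), right)
  | .moveText, some (l, a, _) => (some .growText, some (l, a, .out), right)
  | .growText, none => (some .dropText, none, left)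
  | .growText, some (l, a, .out) => (some .growText', some (l, a, .fresh), right)
  | .growText, some (l, a, _) => (some .growText, some (l, a, .fresh), right)
  | .growText', none => (some .dropText, none, left)
  | .growText', some (l, a, _) => (some .back, some (l, a, .fresh), left)
  | .dropText, none => (some .movePat, none, right)
  | .dropText, some (l, a, _) => (some .dropText, some (l, a, .out), left)
  | .movePat, none => (some .movePat, none, right)
  | .movePat, some (l, .out, b) => (some .movePat, some (l, .out, b), right)
  | .movePat, some (l, _, b) => (some .growPat, some (l, .out, b), right)
  | .growPat, none => (some .clear, some (0, .out, .out), left)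
  | .growPat, some (l, .out, _) => (some .growPat', some (l, .fresh, .fresh), right)
  | .growPat, some (l, _, _) => (some .growPat, some (l, .fresh, .fresh), right)
  | .growPat', none => (some .clear, some (0, .out, .out), left)
  | .growPat', some (l, _, _) => (some .reset, some (l, .fresh, .fresh), left)
  | .clear, none => (some .growPat, none, right)
  | .clear, some (l, _, _) => (some .clear, some (l, .out, .out), left)
  | .incr, none => (none, none, left)
  | .incr, some (l, _, _) =>
    if l = Fin.last K then (some .incr, some (0, .out, .out), left)
    else (some .clear, some (l + 1, .out, .out), left)

/-- The search machine. -/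
def machine (K : ℕ) : Mach (State K) (Symbol K) where
  start := .clear
  blank := none
  trans := trans

section Words

variable {K : ℕ} {w : ℤ → Fin (K + 1)}

/-- The word `w p, w (p + 1), …, w e`, empty if `e < p`. -/
def segment (w : ℤ → Fin (K + 1)) (p e : ℤ) : List (Fin (K + 1)) :=
  (List.range (e + 1 - p).toNat).map fun t : ℕ => w (p + t)

theorem segment_of_lt {p e : ℤ} (h : e < p) : segment w p e = [] := by
  simp [segment, show (e + 1 - p).toNat = 0 by omega]

theorem segment_eq_cons {p e : ℤ} (h : p ≤ e) : segment w p e = w p :: segment w (p + 1) e := by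
  rw [segment, segment, show (e + 1 - p).toNat = (e + 1 - (p + 1)).toNat + 1 by omega,
    List.range_succ_eq_map, List.map_cons, List.map_map]
  simp [Function.comp_def, add_assoc, add_comm (1 : ℤ)]

theorem mem_segment_iff {c : Fin (K + 1)} {p e : ℤ} :
    c ∈ segment w p e ↔ ∃ z, p ≤ z ∧ z ≤ e ∧ w z = c := by
  simp only [segment, List.mem_map, List.mem_range]
  constructor
  · rintro ⟨t, ht, rfl⟩
    exact ⟨p + t, by omega, by omega, rfl⟩
  · rintro ⟨z, hpz, hze, rfl⟩
    exact ⟨(z - p).toNat, by omega, congrArg w (by omega)⟩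

theorem segment_congr {u : ℤ → Fin (K + 1)} {p e : ℤ} (h : ∀ z, p ≤ z → z ≤ e → w z = u z) :
    segment w p e = segment u p e :=
  List.map_congr_left fun t ht => h _ (by omega) (by have := List.mem_range.1 ht; omega)

theorem not_cons_sublist_segment {c : Fin (K + 1)} {l : List (Fin (K + 1))} {q f : ℤ}
    (h : ∀ z, q ≤ z → z ≤ f → w z ≠ c) : ¬ (c :: l).Sublist (segment w q f) := fun hsub =>
  have ⟨z, hqz, hzf, hz⟩ := mem_segment_iff.1 (hsub.subset List.mem_cons_self)
  h z hqz hzf hz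

theorem cons_sublist_segment_iff {l : List (Fin (K + 1))} {q r f : ℤ} (hqr : q ≤ r) (hrf : r ≤ f)
    (h : ∀ z, q ≤ z → z < r → w z ≠ w r) :
    (w r :: l).Sublist (segment w q f) ↔ l.Sublist (segment w (r + 1) f) := by
  induction q, hqr using Int.leInductionDown with
  | base => rw [segment_eq_cons hrf, List.cons_sublist_cons]
  | pred q hq ih =>
    rw [segment_eq_cons (by omega), List.cons_sublist_cons', sub_add_cancel,
      ih fun z hz => h z (by omega)]
    simp [(h (q - 1) le_rfl (by omega)).symm]

theorem block_segment {N : ℕ} {i : ℕ} (hi : 1 ≤ i) (hN : 2 * i ≤ N) :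
    Friedman.block (segment w 1 N) i = segment w i (2 * i) := by
  refine List.ext_getElem ?_ fun t _ _ => ?_
  · simp only [Friedman.block, segment, List.length_take, List.length_drop, List.length_map,
      List.length_range]
    omega
  · simp only [Friedman.block, segment, List.getElem_take, List.getElem_drop, List.getElem_map,
      List.getElem_range]
    exact congrArg w (by omega)

theorem star_segment_iff {N : ℕ} : Friedman.Star (segment w 1 N) ↔
    ∀ i j : ℤ, 1 ≤ i → i < j → 2 * j ≤ N →
      ¬ (segment w i (2 * i)).Sublist (segment w j (2 * j)) := by
  have hlength : (segment w 1 N).length = N := by simp [segment]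
  refine ⟨fun h i j hi hij hj => ?_, fun h i j hi hij hj => ?_⟩
  · lift i to ℕ using by omega
    lift j to ℕ using by omega
    rw [← block_segment (N := N) (by omega) (by omega),
      ← block_segment (N := N) (by omega) (by omega)]
    exact h i j (by omega) (by omega) (by omega)
  · rw [block_segment hi (by omega), block_segment (by omega) (by omega)]
    exact h i j (by omega) (by omega) (by omega)

theorem star_segment_mono {M N : ℕ} (hMN : M ≤ N) (h : Friedman.Star (segment w 1 N)) :
    Friedman.Star (segment w 1 M) :=
  star_segment_iff.2 fun i j hi hij hj => star_segment_iff.1 h i j hi hij (by omega)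

theorem mem_starLengths_iff {N : ℕ} : N ∈ Friedman.starLengths (K + 1) ↔
    ∃ w : ℤ → Fin (K + 1), Friedman.Star (segment w 1 N) := by
  constructor
  · rintro ⟨s, rfl, hs⟩
    have hsegment : segment (fun z => s.getD (z - 1).toNat 0) 1 s.length = s :=
      List.ext_getElem (by simp [segment]) fun t _ ht => by simp [segment, ht]
    exact ⟨_, hsegment.symm ▸ hs⟩
  · rintro ⟨w, hw⟩
    exact ⟨_, by simp [segment], hw⟩

/-- The number with the digits `w 1, …, w n` in base `K + 1`, which is the index of this word in the
lexicographic order of the words of length `n`. -/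
def index (w : ℤ → Fin (K + 1)) : ℕ → ℕ
  | 0 => 0
  | n + 1 => (K + 1) * index w n + w (n + 1 : ℕ)

theorem index_lt (w : ℤ → Fin (K + 1)) (n : ℕ) : index w n < (K + 1) ^ n := by
  induction n with
  | zero => simp [index]
  | succ n ih =>
    rw [index, pow_succ']
    nlinarith [(w (n + 1 : ℕ)).2]

theorem index_congr {u : ℤ → Fin (K + 1)} {n : ℕ} (h : ∀ z, 1 ≤ z → z ≤ n → w z = u z) :
    index w n = index u n := by
  induction n with
  | zero => rfl
  | succ n ih =>
    rw [index, index, ih fun z hz hzn => h z hz (by omega), h _ (by omega) le_rfl]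

theorem segment_eq_of_index_eq {u : ℤ → Fin (K + 1)} {n : ℕ} (h : index w n = index u n) :
    segment w 1 n = segment u 1 n := by
  suffices hletter : ∀ z : ℤ, 1 ≤ z → z ≤ n → w z = u z from segment_congr hletter
  induction n with
  | zero => intro z; omega
  | succ n ih =>
    have hw := (w (n + 1 : ℕ)).2
    have hu := (u (n + 1 : ℕ)).2
    rw [index, index] at h
    have hdiv := congrArg (· / (K + 1)) h
    simp only [Nat.mul_add_div (Nat.succ_pos K), Nat.div_eq_of_lt hw, Nat.div_eq_of_lt hu,
      add_zero] at hdiv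
    intro z hz hzn
    rcases hzn.eq_or_lt with rfl | hlt
    · rw [hdiv] at h
      exact Fin.ext (by omega)
    · exact ih hdiv z hz (by omega)

theorem index_add_one_of_forall_last {n : ℕ} (h : ∀ z : ℤ, 1 ≤ z → z ≤ n → w z = Fin.last K) :
    index w n + 1 = (K + 1) ^ n := by
  induction n with
  | zero => simp [index]
  | succ n ih =>
    rw [index, h _ (by omega) le_rfl, pow_succ, ← ih fun z hz hzn => h z hz (by omega),
      Fin.val_last]
    ring

/-- The word `w` with zeros in place of the letters after the `x`-th. -/
def truncate (w : ℤ → Fin (K + 1)) (x : ℤ) : ℤ → Fin (K + 1) := fun z => if z ≤ x then w z else 0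

/-- If the `x`-th letter of `w` is its last one that is not the largest letter, the lexicographic
successor of `w` among the words of the same length. -/
def next (w : ℤ → Fin (K + 1)) (x : ℤ) : ℤ → Fin (K + 1) :=
  Function.update (truncate w x) x (w x + 1)

theorem index_next {x : ℤ} {n : ℕ} (hx : 1 ≤ x) (hxn : x ≤ n) (hne : w x ≠ Fin.last K)
    (hlast : ∀ z, x < z → z ≤ n → w z = Fin.last K) : index (next w x) n = index w n + 1 := by
  induction n with
  | zero => simp at hxn; omega
  | succ n ih =>
    rw [index, index]
    rcases eq_or_lt_of_le hxn with rfl | hlt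
    · have hindex : index (next w (n + 1 : ℕ)) n = index w n := index_congr fun z _ hzn => by
        rw [next, Function.update_of_ne (by omega), truncate, if_pos (by omega)]
      rw [hindex, next, Function.update_self,
        Fin.val_add_one_of_lt (Fin.lt_last_iff_ne_last.2 hne)]
      ring
    · have hzero : next w x (n + 1 : ℕ) = 0 := by
        rw [next, Function.update_of_ne hlt.ne', truncate, if_neg hlt.not_ge]
      rw [ih (by omega) fun z hz hzn => hlast z hz (by omega), hzero, hlast _ hlt le_rfl,
        Fin.val_zero, Fin.val_last]
      ring

/-- No word before `w` in the lexicographic order of the words of length `N` has property `(*)`. -/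
def NoEarlierStar (w : ℤ → Fin (K + 1)) (N : ℕ) : Prop :=
  ∀ u : ℤ → Fin (K + 1), index u N < index w N → ¬ Friedman.Star (segment u 1 N)

theorem NoEarlierStar.not_star_of_le {N : ℕ} (h : NoEarlierStar w N)
    (hw : ¬ Friedman.Star (segment w 1 N)) {u : ℤ → Fin (K + 1)} (hu : index u N ≤ index w N) :
    ¬ Friedman.Star (segment u 1 N) := by
  rcases hu.eq_or_lt with heq | hlt
  · rwa [segment_eq_of_index_eq heq]
  · exact h u hlt

theorem NoEarlierStar.append {N : ℕ} (h : NoEarlierStar w N) :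
    NoEarlierStar (Function.update w (N + 1) 0) (N + 1) := by
  intro u hu hstar
  have hindex : index (Function.update w (N + 1) 0) N = index w N :=
    index_congr fun z _ hz => Function.update_of_ne (by omega) _ _
  rw [index, index, hindex] at hu
  simp only [Nat.cast_add, Nat.cast_one, Function.update_self, Fin.val_zero, add_zero] at hu
  exact h u (lt_of_mul_lt_mul_left (by omega) (Nat.zero_le (K + 1)))
    (star_segment_mono N.le_succ hstar)

theorem NoEarlierStar.eq_longest_add_one {N : ℕ} (h : NoEarlierStar w N)
    (hw : ¬ Friedman.Star (segment w 1 N)) (hlast : ∀ z : ℤ, 1 ≤ z → z ≤ N → w z = Fin.last K)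
    (hN : N ≤ Friedman.longest (K + 1) + 1) : N = Friedman.longest (K + 1) + 1 := by
  by_contra hne
  obtain ⟨u, hu⟩ := mem_starLengths_iff.1 (Friedman.isGreatest_longest (K + 1)).1
  refine h.not_star_of_le hw ?_ (star_segment_mono (show N ≤ _ by omega) hu)
  have := index_lt u N
  rw [← index_add_one_of_forall_last hlast] at this
  omega

end Words

section Tape

variable {K : ℕ} {N : ℤ} {w : ℤ → Fin (K + 1)} {a b a' b' : ℤ → Mark}

/-- The tape with the word `w` on the cells `1, …, N`, marked for the pattern by `a` and for the
text by `b`. -/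
def markedTape (N : ℤ) (w : ℤ → Fin (K + 1)) (a b : ℤ → Mark) : ℤ → Symbol K := fun z =>
  if 1 ≤ z ∧ z ≤ N then some (w z, a z, b z) else none

theorem markedTape_of_mem {z : ℤ} (hz : 1 ≤ z) (hzN : z ≤ N) :
    markedTape N w a b z = some (w z, a z, b z) := if_pos ⟨hz, hzN⟩

theorem markedTape_of_notMem {z : ℤ} (hz : z < 1 ∨ N < z) : markedTape N w a b z = none :=
  if_neg (by omega)

theorem markedTape_zero : markedTape 0 w a b = fun _ => none :=
  funext fun _ => markedTape_of_notMem (by omega)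

theorem markedTape_congr {u : ℤ → Fin (K + 1)} {z : ℤ} (h : w z = u z ∧ a z = a' z ∧ b z = b' z) :
    markedTape N w a b z = markedTape N u a' b' z := by
  simp only [markedTape, h]

theorem update_markedTape {x : ℤ} (hx : 1 ≤ x) (hxN : x ≤ N) (l : Fin (K + 1)) (m m' : Mark) :
    Function.update (markedTape N w a b) x (some (l, m, m')) =
      markedTape N (Function.update w x l) (Function.update a x m) (Function.update b x m') := by
  funext z
  rcases eq_or_ne z x with rfl | hne
  · simp [markedTape_of_mem hx hxN]
  · rw [Function.update_of_ne hne]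
    exact markedTape_congr (by simp [hne])

theorem update_markedTape_of_notMem {x : ℤ} (hx : x < 1 ∨ N < x) :
    Function.update (markedTape N w a b) x none = markedTape N w a b :=
  Function.update_eq_self_iff.2 (markedTape_of_notMem hx).symm

theorem update_markedTape_succ (hN : 0 ≤ N) (l : Fin (K + 1)) (m m' : Mark) :
    Function.update (markedTape N w a b) (N + 1) (some (l, m, m')) =
      markedTape (N + 1) (Function.update w (N + 1) l) (Function.update a (N + 1) m)
        (Function.update b (N + 1) m') := by
  rw [← update_markedTape (by omega) le_rfl]
  funext z
  rcases eq_or_ne z (N + 1) with rfl | hne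
  · simp
  · rw [Function.update_of_ne hne, Function.update_of_ne hne, markedTape, markedTape]
    congr 1
    exact propext (by omega)

theorem reaches_mark {q : State K} {q' : Option (State K)} {x : ℤ} {m m' : Mark} {d : Turing.Dir}
    (hx : 1 ≤ x) (hxN : x ≤ N)
    (h : trans q (some (w x, a x, b x)) = (q', some (w x, m, m'), d)) :
    (machine K).Reaches ⟨some q, x, markedTape N w a b⟩ ⟨q', x + TM.shift d,
      markedTape N w (Function.update a x m) (Function.update b x m')⟩ :=
  (machine K).reaches_step (e := some (w x, m, m'))
    (by rw [markedTape_of_mem hx hxN]; exact h)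
    (by rw [update_markedTape hx hxN, Function.update_eq_self])

theorem reaches_pass {q : State K} {x y : ℤ} (hx : 1 ≤ x) (hxy : x ≤ y) (hyN : y ≤ N + 1)
    (hin : ∀ z, x ≤ z → z < y →
      trans q (some (w z, a z, b z)) = (some q, some (w z, a' z, b' z), .right))
    (hout : ∀ z, z < x ∨ y ≤ z → a' z = a z ∧ b' z = b z) :
    (machine K).Reaches ⟨some q, x, markedTape N w a b⟩ ⟨some q, y, markedTape N w a' b'⟩ :=
  (machine K).reaches_sweep_right hxy
    (fun z hxz hzy => by
      rw [markedTape_of_mem (by omega) (by omega), markedTape_of_mem (by omega) (by omega)]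
      exact hin z hxz hzy)
    (fun z hz => markedTape_congr ⟨rfl, hout z hz⟩)

theorem reaches_turn {q q' : State K} (h : trans q none = (some q', none, .left)) :
    (machine K).Reaches ⟨some q, N + 1, markedTape N w a b⟩ ⟨some q', N, markedTape N w a b⟩ := by
  convert (machine K).reaches_step (h := N + 1) (tape := markedTape N w a b) (d := .left)
    (by rw [markedTape_of_notMem (by omega)]; exact h)
    (update_markedTape_of_notMem (by omega)).symm using 2
  simp [TM.shift]

theorem reaches_rewind {q q' : State K} {x : ℤ} (hx : 0 ≤ x) (hxN : x ≤ N)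
    (h : trans q none = (some q', none, .right))
    (hin : ∀ z, 1 ≤ z → z ≤ x →
      trans q (some (w z, a z, b z)) = (some q, some (w z, a' z, b' z), .left))
    (hout : ∀ z, x < z → z ≤ N → a' z = a z ∧ b' z = b z) :
    (machine K).Reaches ⟨some q, x, markedTape N w a b⟩ ⟨some q', 1, markedTape N w a' b'⟩ := by
  refine ((machine K).reaches_sweep_left hx (tape' := markedTape N w a' b') ?_ ?_).trans
    ((machine K).reaches_step (d := .right) (by rw [markedTape_of_notMem (by omega)]; exact h)
      (update_markedTape_of_notMem (by omega)).symm)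
  · intro z hz hzx
    rw [markedTape_of_mem (by omega) (by omega), markedTape_of_mem (by omega) (by omega)]
    exact hin z (by omega) hzx
  · intro z hz
    by_cases hmem : 1 ≤ z ∧ z ≤ N
    · exact markedTape_congr ⟨rfl, hout z (by omega) hmem.2⟩
    · rw [markedTape_of_notMem (by omega), markedTape_of_notMem (by omega)]

theorem reaches_back {x : ℤ} (hx : 0 ≤ x) (hxN : x ≤ N) :
    (machine K).Reaches ⟨some .back, x, markedTape N w a b⟩
      ⟨some .seek, 1, markedTape N w a b⟩ :=
  reaches_rewind hx hxN rfl (fun _ _ _ => rfl) fun _ _ _ => ⟨rfl, rfl⟩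

end Tape

section BlockMarks

variable {lo mid hi z : ℤ}

/-- The marks of the block from `lo` to `hi` in which the letters before `mid` have been used. -/
def blockMarks (lo mid hi : ℤ) : ℤ → Mark := fun z =>
  if lo ≤ z ∧ z < mid then .used else if mid ≤ z ∧ z ≤ hi then .fresh else .out

theorem blockMarks_eq_out_of_lt (hlo : lo ≤ mid) (hz : z < lo) : blockMarks lo mid hi z = .out := by
  rw [blockMarks, if_neg (by omega), if_neg (by omega)]

theorem blockMarks_eq_out_of_gt (hmid : mid ≤ hi + 1) (hz : hi < z) :
    blockMarks lo mid hi z = .out := by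
  rw [blockMarks, if_neg (by omega), if_neg (by omega)]

theorem blockMarks_eq_used (hlo : lo ≤ z) (hmid : z < mid) : blockMarks lo mid hi z = .used :=
  if_pos ⟨hlo, hmid⟩

theorem blockMarks_eq_fresh (hmid : mid ≤ z) (hhi : z ≤ hi) : blockMarks lo mid hi z = .fresh := by
  rw [blockMarks, if_neg (by omega), if_pos ⟨hmid, hhi⟩]

theorem blockMarks_ne_fresh (hz : z < mid ∨ hi < z) : blockMarks lo mid hi z ≠ .fresh := by
  unfold blockMarks
  split_ifs <;> first | omega | simp

theorem blockMarks_congr {mid' : ℤ} (hz : z < mid ↔ z < mid') :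
    blockMarks lo mid hi z = blockMarks lo mid' hi z := by
  simp only [blockMarks, hz, ← not_lt (b := mid), ← not_lt (b := mid')]

theorem blockMarks_advance (hlo : lo ≤ mid) :
    blockMarks lo (mid + 1) hi = Function.update (blockMarks lo mid hi) mid .used := by
  funext z
  rw [Function.update_apply]
  unfold blockMarks
  split_ifs <;> first | rfl | omega

theorem blockMarks_dropFirst :
    blockMarks (lo + 1) (lo + 1) hi = Function.update (blockMarks lo lo hi) lo .out := by
  funext z
  rw [Function.update_apply]
  unfold blockMarks
  split_ifs <;> first | rfl | omega

theorem blockMarks_extend (hmid : mid ≤ hi + 1) :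
    blockMarks lo mid (hi + 1) = Function.update (blockMarks lo mid hi) (hi + 1) .fresh := by
  funext z
  rw [Function.update_apply]
  unfold blockMarks
  split_ifs <;> first | rfl | omega

theorem blockMarks_empty : blockMarks lo lo (lo - 1) = fun _ => .out := by
  funext z
  rw [blockMarks, if_neg (by omega), if_neg (by omega)]

theorem refresh_blockMarks (hlo : lo ≤ mid) (hmid : mid ≤ hi + 1) :
    (blockMarks lo mid hi z).refresh = blockMarks lo lo hi z := by
  unfold blockMarks
  split_ifs <;> first | rfl | omega

end BlockMarks

section Comparison

variable {K : ℕ} {N : ℤ} {w : ℤ → Fin (K + 1)} {a b : ℤ → Mark} {i p e j q f : ℤ}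

theorem trans_seek_of_ne_fresh {l : Fin (K + 1)} {m m' : Mark} (h : m ≠ .fresh) :
    trans .seek (some (l, m, m')) = (some .seek, some (l, m, m'), .right) := by
  cases m <;> simp_all [trans]

theorem trans_carry_of_ne_fresh {c l : Fin (K + 1)} {m m' : Mark} (h : m' ≠ .fresh) :
    trans (.carry c) (some (l, m, m')) = (some (.carry c), some (l, m, m'), .right) := by
  cases m' <;> simp_all [trans]

theorem trans_carry_of_ne {c l : Fin (K + 1)} {m : Mark} (h : l ≠ c) :
    trans (.carry c) (some (l, m, .fresh)) = (some (.carry c), some (l, m, .used), .right) := by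
  simp [trans, h]

theorem reaches_carry (hi : 1 ≤ i) (hip : i ≤ p) (hpe : p ≤ e) (heN : e ≤ N) :
    (machine K).Reaches ⟨some .seek, 1, markedTape N w (blockMarks i p e) b⟩
      ⟨some (.carry (w p)), p + 1, markedTape N w (blockMarks i (p + 1) e) b⟩ := by
  have hmark := reaches_mark (N := N) (w := w) (a := blockMarks i p e) (b := b) (q := .seek)
    (x := p) (by omega) (by omega) (by rw [blockMarks_eq_fresh le_rfl hpe]; rfl)
  rw [Function.update_eq_self, ← blockMarks_advance hip] at hmark
  exact (reaches_pass le_rfl (by omega) (by omega)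
    (fun z _ hz => trans_seek_of_ne_fresh (blockMarks_ne_fresh (.inl hz)))
    fun _ _ => ⟨rfl, rfl⟩).trans hmark

theorem reaches_carry_skip {c : Fin (K + 1)} {x r : ℤ} (hx : 1 ≤ x) (hxq : x ≤ q) (hjq : j ≤ q)
    (hqr : q ≤ r) (hrf : r ≤ f + 1) (hfN : f ≤ N) (hskip : ∀ z, q ≤ z → z < r → w z ≠ c) :
    (machine K).Reaches ⟨some (.carry c), x, markedTape N w a (blockMarks j q f)⟩
      ⟨some (.carry c), r, markedTape N w a (blockMarks j r f)⟩ := by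
  refine reaches_pass hx (by omega) (by omega) (fun z _ hzr => ?_)
    fun z hz => ⟨rfl, blockMarks_congr (by omega)⟩
  rcases lt_or_ge z q with hzq | hqz
  · rw [blockMarks_congr (mid := r) (mid' := q) (by omega)]
    exact trans_carry_of_ne_fresh (blockMarks_ne_fresh (.inl hzq))
  · rw [blockMarks_eq_fresh hqz (by omega), blockMarks_eq_used (by omega) hzr]
    exact trans_carry_of_ne (hskip z hqz hzr)

theorem reaches_seek_of_first {x r : ℤ} (hx : 1 ≤ x) (hxq : x ≤ q) (hjq : j ≤ q) (hqr : q ≤ r)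
    (hrf : r ≤ f) (hfN : f ≤ N) (hskip : ∀ z, q ≤ z → z < r → w z ≠ w r) :
    (machine K).Reaches ⟨some (.carry (w r)), x, markedTape N w a (blockMarks j q f)⟩
      ⟨some .seek, 1, markedTape N w a (blockMarks j (r + 1) f)⟩ := by
  have hmark := reaches_mark (N := N) (w := w) (a := a) (b := blockMarks j r f)
    (q := .carry (w r)) (x := r) (by omega) (by omega)
    (by rw [blockMarks_eq_fresh le_rfl hrf]; exact if_pos rfl)
  rw [Function.update_eq_self, ← blockMarks_advance (by omega)] at hmark
  exact ((reaches_carry_skip hx hxq hjq hqr (by omega) hfN hskip).trans hmark).trans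
    (reaches_back (by simp only [TM.shift]; omega) (by simp only [TM.shift]; omega))

theorem reaches_reset_of_notMem {c : Fin (K + 1)} {x : ℤ} (hx : 1 ≤ x) (hxq : x ≤ q) (hjq : j ≤ q)
    (hqf : q ≤ f + 1) (hfN : f ≤ N) (hskip : ∀ z, q ≤ z → z ≤ f → w z ≠ c) :
    (machine K).Reaches ⟨some (.carry c), x, markedTape N w a (blockMarks j q f)⟩
      ⟨some .reset, N, markedTape N w a (blockMarks j (f + 1) f)⟩ :=
  ((reaches_carry_skip hx hxq hjq hqf le_rfl hfN fun z hqz hz => hskip z hqz (by omega)).trans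
    (reaches_pass (by omega) (by omega) le_rfl
      (fun z _ _ => trans_carry_of_ne_fresh (blockMarks_ne_fresh (by omega)))
      fun _ _ => ⟨rfl, rfl⟩)).trans (reaches_turn rfl)

theorem exists_first_or_forall_ne (w : ℤ → Fin (K + 1)) (c : Fin (K + 1)) (q f : ℤ) :
    (∃ r, q ≤ r ∧ r ≤ f ∧ w r = c ∧ ∀ z, q ≤ z → z < r → w z ≠ c) ∨
      ∀ z, q ≤ z → z ≤ f → w z ≠ c := by
  by_contra! h
  obtain ⟨hfirst, z, hz⟩ := h
  obtain ⟨r, ⟨hqr, hrf, hr⟩, hmin⟩ := Int.exists_least_of_bdd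
    (P := fun z => q ≤ z ∧ z ≤ f ∧ w z = c) ⟨q, fun z hz => hz.1⟩ ⟨z, hz⟩
  obtain ⟨y, hqy, hyr, hy⟩ := hfirst r hqr hrf hr
  exact (hmin y ⟨hqy, by omega, hy⟩).not_gt hyr

theorem reaches_incr_of_sublist (hi : 1 ≤ i) (heN : e ≤ N) (hfN : f ≤ N) (hip : i ≤ p)
    (hpe : p ≤ e + 1) (hpq : p < q) (hjq : j ≤ q)
    (hsub : (segment w p e).Sublist (segment w q f)) :
    ∃ a b, (machine K).Reaches
      ⟨some .seek, 1, markedTape N w (blockMarks i p e) (blockMarks j q f)⟩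
      ⟨some .incr, N, markedTape N w a b⟩ := by
  induction p, hpe using Int.leInductionDown generalizing q with
  | base =>
    exact ⟨_, _, (reaches_pass le_rfl (by omega) le_rfl
      (fun z _ _ => trans_seek_of_ne_fresh (blockMarks_ne_fresh (by omega)))
      fun _ _ => ⟨rfl, rfl⟩).trans (reaches_turn rfl)⟩
  | pred p hp ih =>
    rw [segment_eq_cons (by omega), sub_add_cancel] at hsub
    rcases exists_first_or_forall_ne w (w (p - 1)) q f with ⟨r, hqr, hrf, hr, hskip⟩ | hnone
    · rw [← hr] at hskip hsub
      obtain ⟨a, b, hrest⟩ := ih (q := r + 1) (by omega) (by omega) (by omega)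
        ((cons_sublist_segment_iff hqr hrf hskip).1 hsub)
      have hcarry := reaches_carry (w := w) (b := blockMarks j q f) hi hip (by omega) heN
      rw [← hr, sub_add_cancel] at hcarry
      exact ⟨a, b, (hcarry.trans (reaches_seek_of_first (by omega) (by omega) hjq hqr hrf hfN
        hskip)).trans hrest⟩
    · exact absurd hsub (not_cons_sublist_segment hnone)

theorem reaches_reset_of_not_sublist (hi : 1 ≤ i) (heN : e ≤ N) (hfN : f ≤ N) (hip : i ≤ p)
    (hpe : p ≤ e + 1) (hpq : p < q) (hjq : j ≤ q) (hqf : q ≤ f + 1)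
    (hsub : ¬ (segment w p e).Sublist (segment w q f)) :
    ∃ p', i ≤ p' ∧ p' ≤ e + 1 ∧ (machine K).Reaches
      ⟨some .seek, 1, markedTape N w (blockMarks i p e) (blockMarks j q f)⟩
      ⟨some .reset, N, markedTape N w (blockMarks i p' e) (blockMarks j (f + 1) f)⟩ := by
  induction p, hpe using Int.leInductionDown generalizing q with
  | base => simp [segment_of_lt] at hsub
  | pred p hp ih =>
    rw [segment_eq_cons (by omega), sub_add_cancel] at hsub
    have hcarry := reaches_carry (w := w) (b := blockMarks j q f) hi hip (by omega) heN
    rw [sub_add_cancel] at hcarry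
    rcases exists_first_or_forall_ne w (w (p - 1)) q f with ⟨r, hqr, hrf, hr, hskip⟩ | hnone
    · rw [← hr] at hskip hsub hcarry
      obtain ⟨p', hip', hpe', hrest⟩ := ih (q := r + 1) (by omega) (by omega) (by omega) (by omega)
        (mt (cons_sublist_segment_iff hqr hrf hskip).2 hsub)
      exact ⟨p', hip', hpe', (hcarry.trans (reaches_seek_of_first (by omega) (by omega) hjq hqr hrf
        hfN hskip)).trans hrest⟩
    · exact ⟨p, by omega, hp, hcarry.trans
        (reaches_reset_of_notMem (by omega) (by omega) hjq hqf hfN hnone)⟩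

theorem reaches_moveText {x : ℤ} (hx : 0 ≤ x) (hxN : x ≤ N) (hip : i ≤ p) (hpe : p ≤ e + 1)
    (hpx : p = i ∨ p ≤ x + 1) (hjq : j ≤ q) (hqf : q ≤ f + 1) (hqx : q = j ∨ q ≤ x + 1) :
    (machine K).Reaches
      ⟨some .reset, x, markedTape N w (blockMarks i p e) (blockMarks j q f)⟩
      ⟨some .moveText, 1, markedTape N w (blockMarks i i e) (blockMarks j j f)⟩ :=
  reaches_rewind hx hxN rfl
    (fun z _ _ => by rw [← refresh_blockMarks hip hpe, ← refresh_blockMarks hjq hqf]; rfl)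
    fun _ _ _ => ⟨blockMarks_congr (by omega), blockMarks_congr (by omega)⟩

end Comparison

section Phases

variable {K : ℕ} {N : ℤ} {w : ℤ → Fin (K + 1)} {a b : ℤ → Mark} {i j : ℤ}

/-- The machine is about to make the block at `i` the pattern. At `i = 1` this is the beginning of
the test of the word `w`. -/
def patternCfg (N : ℤ) (w : ℤ → Fin (K + 1)) (i : ℤ) : Mach.Cfg (State K) (Symbol K) :=
  ⟨some .growPat, i, markedTape N w (blockMarks i i (2 * i - 2)) fun _ => .out⟩

/-- The pattern is the block at `i`, and the machine is about to move the text on from the block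
at `j`. -/
def textCfg (N : ℤ) (w : ℤ → Fin (K + 1)) (i j : ℤ) : Mach.Cfg (State K) (Symbol K) :=
  ⟨some .moveText, 1, markedTape N w (blockMarks i i (2 * i)) (blockMarks j j (2 * j))⟩

/-- The machine is about to compare the pattern, the block at `i`, with the text, the block
at `j`. -/
def compareCfg (N : ℤ) (w : ℤ → Fin (K + 1)) (i j : ℤ) : Mach.Cfg (State K) (Symbol K) :=
  ⟨some .seek, 1, markedTape N w (blockMarks i i (2 * i)) (blockMarks j j (2 * j))⟩

theorem reaches_patternCfg_one {x : ℤ} (hx : 0 ≤ x) (hxN : x ≤ N)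
    (hout : ∀ z, x < z → z ≤ N → a z = .out ∧ b z = .out) :
    (machine K).Reaches ⟨some .clear, x, markedTape N w a b⟩ (patternCfg N w 1) := by
  rw [patternCfg, show (2 * 1 - 2 : ℤ) = 1 - 1 by norm_num, blockMarks_empty]
  exact reaches_rewind hx hxN rfl (fun _ _ _ => rfl)
    fun z hxz hz => ⟨(hout z hxz hz).1.symm, (hout z hxz hz).2.symm⟩

theorem reaches_growPat (hi : 1 ≤ i) (hiN : 2 * i - 2 ≤ N) :
    (machine K).Reaches (patternCfg N w i) ⟨some .growPat, 2 * i - 1,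
      markedTape N w (blockMarks i i (2 * i - 2)) (blockMarks i i (2 * i - 2))⟩ :=
  reaches_pass hi (by omega) (by omega)
    (fun z hz hz' => by rw [blockMarks_eq_fresh hz (by omega)]; rfl)
    fun z hz => ⟨rfl, by
      rcases hz with hz | hz
      · rw [blockMarks_eq_out_of_lt le_rfl hz]
      · rw [blockMarks_eq_out_of_gt (by omega) (by omega)]⟩

theorem reaches_growPat' (hi : 1 ≤ i) (hiN : 2 * i - 1 ≤ N) :
    (machine K).Reaches (patternCfg N w i) ⟨some .growPat', 2 * i,
      markedTape N w (blockMarks i i (2 * i - 1)) (blockMarks i i (2 * i - 1))⟩ := by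
  have hmark := reaches_mark (N := N) (w := w) (a := blockMarks i i (2 * i - 2))
    (b := blockMarks i i (2 * i - 2)) (q := .growPat) (x := 2 * i - 1) (by omega) hiN
    (by rw [blockMarks_eq_out_of_gt (by omega) (by omega)]; rfl)
  have hextend := blockMarks_extend (lo := i) (mid := i) (hi := 2 * i - 2) (by omega)
  rw [show (2 * i - 2 + 1 : ℤ) = 2 * i - 1 by ring] at hextend
  rw [← hextend, TM.shift, sub_add_cancel] at hmark
  exact (reaches_growPat hi (by omega)).trans hmark

theorem reaches_textCfg_of_pattern (hi : 1 ≤ i) (hiN : 2 * i ≤ N) :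
    (machine K).Reaches (patternCfg N w i) (textCfg N w i i) := by
  have hmark := reaches_mark (N := N) (w := w) (a := blockMarks i i (2 * i - 1))
    (b := blockMarks i i (2 * i - 1)) (q := .growPat') (x := 2 * i) (by omega) hiN rfl
  have hextend := blockMarks_extend (lo := i) (mid := i) (hi := 2 * i - 1) (by omega)
  rw [sub_add_cancel] at hextend
  rw [← hextend, TM.shift] at hmark
  exact ((reaches_growPat' hi (by omega)).trans hmark).trans
    (reaches_moveText (by omega) (by omega) le_rfl (by omega) (.inl rfl) le_rfl (by omega)
      (.inl rfl))

theorem reaches_append (hi : 1 ≤ i) (hiN : 2 * i - 2 ≤ N) (hNi : N < 2 * i) :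
    (machine K).Reaches (patternCfg N w i)
      (patternCfg (N + 1) (Function.update w (N + 1) 0) 1) := by
  have happend {q : State K} {a b : ℤ → Mark}
      (hq : trans q none = (some .clear, some (0, .out, .out), .left)) :
      (machine K).Reaches ⟨some q, N + 1, markedTape N w a b⟩
        (patternCfg (N + 1) (Function.update w (N + 1) 0) 1) := by
    refine ((machine K).reaches_step (by rw [markedTape_of_notMem (.inr (by omega))]; exact hq)
      (update_markedTape_succ (by omega) _ _ _).symm).trans
      (reaches_patternCfg_one (by simp only [TM.shift]; omega) (by simp only [TM.shift]; omega)
        fun z hz hzN => ?_)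
    obtain rfl : z = N + 1 := by simp only [TM.shift] at hz; omega
    simp
  rcases (show N + 1 = 2 * i - 1 ∨ N + 1 = 2 * i by omega) with heq | heq
  · exact (heq ▸ reaches_growPat hi hiN).trans (happend rfl)
  · exact (heq ▸ reaches_growPat' hi (by omega)).trans (happend rfl)

theorem reaches_growText (hj : 1 ≤ j) (hjN : 2 * j ≤ N) :
    (machine K).Reaches (textCfg N w i j) ⟨some .growText, 2 * j + 1,
      markedTape N w (blockMarks i i (2 * i)) (blockMarks (j + 1) (j + 1) (2 * j))⟩ := by
  have hpass : (machine K).Reaches (textCfg N w i j) ⟨some .moveText, j,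
      markedTape N w (blockMarks i i (2 * i)) (blockMarks j j (2 * j))⟩ :=
    reaches_pass le_rfl hj (by omega)
      (fun z _ hz => by rw [blockMarks_eq_out_of_lt (lo := j) le_rfl hz]; rfl)
      fun _ _ => ⟨rfl, rfl⟩
  have hmark := reaches_mark (N := N) (w := w) (a := blockMarks i i (2 * i))
    (b := blockMarks j j (2 * j)) (q := .moveText) (x := j) hj (by omega)
    (by rw [blockMarks_eq_fresh (lo := j) le_rfl (by omega)]; rfl)
  rw [Function.update_eq_self, ← blockMarks_dropFirst, TM.shift] at hmark
  exact (hpass.trans hmark).trans (reaches_pass (by omega) (by omega) (by omega)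
    (fun z hz hz' => by rw [blockMarks_eq_fresh (lo := j + 1) hz (by omega)]; rfl)
    fun _ _ => ⟨rfl, rfl⟩)

theorem reaches_growText' (hj : 1 ≤ j) (hjN : 2 * j + 1 ≤ N) :
    (machine K).Reaches (textCfg N w i j) ⟨some .growText', 2 * j + 1 + 1,
      markedTape N w (blockMarks i i (2 * i)) (blockMarks (j + 1) (j + 1) (2 * j + 1))⟩ := by
  have hmark := reaches_mark (N := N) (w := w) (a := blockMarks i i (2 * i))
    (b := blockMarks (j + 1) (j + 1) (2 * j)) (q := .growText) (x := 2 * j + 1) (by omega) hjN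
    (by rw [blockMarks_eq_out_of_gt (lo := j + 1) (by omega) (by omega)]; rfl)
  rw [Function.update_eq_self, ← blockMarks_extend (by omega), TM.shift] at hmark
  exact (reaches_growText hj (by omega)).trans hmark

theorem reaches_compareCfg (hj : 1 ≤ j) (hjN : 2 * (j + 1) ≤ N) :
    (machine K).Reaches (textCfg N w i j) (compareCfg N w i (j + 1)) := by
  have hmark := reaches_mark (N := N) (w := w) (a := blockMarks i i (2 * i))
    (b := blockMarks (j + 1) (j + 1) (2 * j + 1)) (q := .growText') (x := 2 * j + 1 + 1)
    (by omega) (by omega) rfl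
  rw [Function.update_eq_self, ← blockMarks_extend (by omega), TM.shift,
    show (2 * j + 1 + 1 : ℤ) = 2 * (j + 1) by ring] at hmark
  have hgrow := reaches_growText' (w := w) (i := i) hj (show 2 * j + 1 ≤ N by omega)
  rw [show (2 * j + 1 + 1 : ℤ) = 2 * (j + 1) by ring] at hgrow
  rw [compareCfg]
  exact (hgrow.trans hmark).trans (reaches_back (by omega) (by omega))

theorem reaches_dropText (hj : 1 ≤ j) (hjN : 2 * j ≤ N) (hNj : N < 2 * (j + 1)) :
    ∃ b, (machine K).Reaches (textCfg N w i j)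
      ⟨some .dropText, N, markedTape N w (blockMarks i i (2 * i)) b⟩ := by
  rcases (show N = 2 * j ∨ N = 2 * j + 1 by omega) with rfl | rfl
  · exact ⟨_, (reaches_growText hj le_rfl).trans (reaches_turn rfl)⟩
  · exact ⟨_, (reaches_growText' hj le_rfl).trans (reaches_turn rfl)⟩

theorem reaches_patternCfg_succ (hi : 1 ≤ i) (hiN : 2 * i ≤ N) :
    (machine K).Reaches ⟨some .dropText, N, markedTape N w (blockMarks i i (2 * i)) b⟩
      (patternCfg N w (i + 1)) := by
  have hdrop : (machine K).Reaches
      ⟨some .dropText, N, markedTape N w (blockMarks i i (2 * i)) b⟩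
      ⟨some .movePat, 1, markedTape N w (blockMarks i i (2 * i)) fun _ => .out⟩ :=
    reaches_rewind (by omega) le_rfl rfl (fun _ _ _ => rfl) fun _ _ _ => by omega
  have hpass : (machine K).Reaches
      ⟨some .movePat, 1, markedTape N w (blockMarks i i (2 * i)) fun _ => .out⟩
      ⟨some .movePat, i, markedTape N w (blockMarks i i (2 * i)) fun _ => .out⟩ :=
    reaches_pass le_rfl hi (by omega)
      (fun z _ hz => by rw [blockMarks_eq_out_of_lt (lo := i) le_rfl hz]; rfl)
      fun _ _ => ⟨rfl, rfl⟩
  have hmark := reaches_mark (N := N) (w := w) (a := blockMarks i i (2 * i))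
    (b := fun _ => .out) (q := .movePat) (x := i) hi (by omega)
    (by rw [blockMarks_eq_fresh (lo := i) le_rfl (by omega)]; rfl)
  rw [Function.update_eq_self_iff.2 rfl, ← blockMarks_dropFirst, TM.shift] at hmark
  rw [patternCfg, show (2 * (i + 1) - 2 : ℤ) = 2 * i by ring]
  exact (hdrop.trans hpass).trans hmark

end Phases

section Test

variable {K : ℕ} {N : ℤ} {w : ℤ → Fin (K + 1)} {i j : ℤ}

theorem reaches_incr_of_block_sublist (hi : 1 ≤ i) (hij : i < j) (hj : 2 * j ≤ N)
    (hsub : (segment w i (2 * i)).Sublist (segment w j (2 * j))) :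
    ∃ a b, (machine K).Reaches (compareCfg N w i j) ⟨some .incr, N, markedTape N w a b⟩ :=
  reaches_incr_of_sublist hi (by omega) hj le_rfl (by omega) hij le_rfl hsub

theorem reaches_textCfg_of_compare (hi : 1 ≤ i) (hij : i < j) (hj : 2 * j ≤ N)
    (hsub : ¬ (segment w i (2 * i)).Sublist (segment w j (2 * j))) :
    (machine K).Reaches (compareCfg N w i j) (textCfg N w i j) := by
  obtain ⟨p, hip, hp, hreset⟩ := reaches_reset_of_not_sublist hi (by omega) hj le_rfl (by omega)
    hij le_rfl (by omega) hsub
  exact hreset.trans (reaches_moveText (by omega) le_rfl hip hp (by omega) (by omega) le_rfl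
    (by omega))

theorem reaches_incr_of_text {j j' : ℤ} (hi : 1 ≤ i) (hij : i ≤ j) (hjj' : j < j')
    (hj' : 2 * j' ≤ N) (hsub : (segment w i (2 * i)).Sublist (segment w j' (2 * j'))) :
    ∃ a b, (machine K).Reaches (textCfg N w i j) ⟨some .incr, N, markedTape N w a b⟩ := by
  have hcompare := reaches_compareCfg (w := w) (i := i) (j := j) (N := N) (by omega) (by omega)
  by_cases hnext : (segment w i (2 * i)).Sublist (segment w (j + 1) (2 * (j + 1)))
  · obtain ⟨a, b, hincr⟩ := reaches_incr_of_block_sublist (N := N) hi (by omega) (by omega) hnext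
    exact ⟨a, b, hcompare.trans hincr⟩
  · have hne : j + 1 ≠ j' := by rintro rfl; exact hnext hsub
    obtain ⟨a, b, hincr⟩ := reaches_incr_of_text (j := j + 1) hi (by omega) (by omega) hj' hsub
    exact ⟨a, b, (hcompare.trans (reaches_textCfg_of_compare hi (by omega) (by omega)
      hnext)).trans hincr⟩
termination_by (j' - j).toNat

theorem reaches_pattern_of_text {j : ℤ} (hi : 1 ≤ i) (hij : i ≤ j) (hj : 2 * j ≤ N)
    (hsub : ∀ j', j < j' → 2 * j' ≤ N →
      ¬ (segment w i (2 * i)).Sublist (segment w j' (2 * j'))) :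
    (machine K).Reaches (textCfg N w i j) (patternCfg N w (i + 1)) := by
  by_cases hnext : 2 * (j + 1) ≤ N
  · exact ((reaches_compareCfg (by omega) hnext).trans (reaches_textCfg_of_compare hi (by omega)
      hnext (hsub _ (by omega) hnext))).trans
      (reaches_pattern_of_text hi (by omega) hnext fun j' hj' => hsub j' (by omega))
  · obtain ⟨b, hdrop⟩ := reaches_dropText (w := w) (i := i) (by omega) hj (by omega)
    exact hdrop.trans (reaches_patternCfg_succ hi (by omega))
termination_by (N - j).toNat

theorem reaches_incr_of_pattern {i i' j' : ℤ} (hi : 1 ≤ i) (hii' : i ≤ i') (hij' : i' < j')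
    (hj' : 2 * j' ≤ N) (hsub : (segment w i' (2 * i')).Sublist (segment w j' (2 * j'))) :
    ∃ a b, (machine K).Reaches (patternCfg N w i) ⟨some .incr, N, markedTape N w a b⟩ := by
  have htext := reaches_textCfg_of_pattern (w := w) (N := N) hi (by omega)
  by_cases hcur : ∃ j, i < j ∧ 2 * j ≤ N ∧ (segment w i (2 * i)).Sublist (segment w j (2 * j))
  · obtain ⟨j, hij, hj, hcur⟩ := hcur
    obtain ⟨a, b, hincr⟩ := reaches_incr_of_text hi le_rfl hij hj hcur
    exact ⟨a, b, htext.trans hincr⟩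
  · have hne : i ≠ i' := by rintro rfl; exact hcur ⟨j', hij', hj', hsub⟩
    obtain ⟨a, b, hincr⟩ := reaches_incr_of_pattern (i := i + 1) (by omega) (by omega) hij' hj' hsub
    exact ⟨a, b, (htext.trans (reaches_pattern_of_text hi le_rfl (by omega)
      fun j hij hj hsub => hcur ⟨j, hij, hj, hsub⟩)).trans hincr⟩
termination_by (i' - i).toNat

theorem reaches_append_of_pattern {i : ℤ} (hi : 1 ≤ i) (hiN : 2 * i - 2 ≤ N)
    (hsub : ∀ i' j', i ≤ i' → i' < j' → 2 * j' ≤ N →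
      ¬ (segment w i' (2 * i')).Sublist (segment w j' (2 * j'))) :
    (machine K).Reaches (patternCfg N w i)
      (patternCfg (N + 1) (Function.update w (N + 1) 0) 1) := by
  by_cases hnext : 2 * i ≤ N
  · exact ((reaches_textCfg_of_pattern hi hnext).trans (reaches_pattern_of_text hi le_rfl hnext
      fun j' => hsub i j' le_rfl)).trans
      (reaches_append_of_pattern (by omega) (by omega) fun i' j' hi' => hsub i' j' (by omega))
  · exact reaches_append hi hiN (by omega)
termination_by (N - i).toNat

theorem reaches_append_of_star {N : ℕ} (h : Friedman.Star (segment w 1 N)) :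
    (machine K).Reaches (patternCfg N w 1)
      (patternCfg (N + 1 : ℕ) (Function.update w (N + 1) 0) 1) :=
  reaches_append_of_pattern le_rfl (by omega) (star_segment_iff.1 h)

theorem reaches_incr_of_not_star {N : ℕ} (h : ¬ Friedman.Star (segment w 1 N)) :
    ∃ a b, (machine K).Reaches (patternCfg N w 1) ⟨some .incr, N, markedTape N w a b⟩ := by
  rw [star_segment_iff] at h
  push Not at h
  obtain ⟨i, j, hi, hij, hj, hsub⟩ := h
  exact reaches_incr_of_pattern le_rfl hi hij hj hsub

end Test

section Search

variable {K : ℕ} {w u : ℤ → Fin (K + 1)} {a b a' b' : ℤ → Mark}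

theorem reaches_sweep_last {N x : ℤ} (hx : 0 ≤ x) (hxN : x ≤ N)
    (hin : ∀ z, x < z → z ≤ N → w z = Fin.last K ∧ u z = 0 ∧ a' z = .out ∧ b' z = .out)
    (hout : ∀ z, 1 ≤ z → z ≤ x → w z = u z ∧ a z = a' z ∧ b z = b' z) :
    (machine K).Reaches ⟨some .incr, N, markedTape N w a b⟩
      ⟨some .incr, x, markedTape N u a' b'⟩ := by
  refine (machine K).reaches_sweep_left hxN (fun z hxz hz => ?_) fun z hz => ?_
  · obtain ⟨hw, hu, ha, hb⟩ := hin z hxz hz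
    rw [markedTape_of_mem (by omega) hz, markedTape_of_mem (by omega) hz, hw, hu, ha, hb]
    exact if_pos rfl
  · by_cases hmem : 1 ≤ z ∧ z ≤ x
    · exact (markedTape_congr (hout z hmem.1 hmem.2)).symm
    · rw [markedTape_of_notMem (by omega), markedTape_of_notMem (by omega)]

theorem reaches_next {N x : ℤ} (hx : 1 ≤ x) (hxN : x ≤ N) (hne : w x ≠ Fin.last K)
    (hlast : ∀ z, x < z → z ≤ N → w z = Fin.last K) :
    (machine K).Reaches ⟨some .incr, N, markedTape N w a b⟩ (patternCfg N (next w x) 1) := by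
  let clearBeyond (c : ℤ → Mark) (z : ℤ) : Mark := if z ≤ x then c z else .out
  have hsweep : (machine K).Reaches ⟨some .incr, N, markedTape N w a b⟩
      ⟨some .incr, x, markedTape N (truncate w x) (clearBeyond a) (clearBeyond b)⟩ :=
    reaches_sweep_last (by omega) hxN
      (fun z hz hzN => by simp [hlast z hz hzN, truncate, clearBeyond, hz.not_ge])
      fun z _ hz => by simp [truncate, clearBeyond, hz]
  have hletter := (machine K).reaches_step (q := .incr) (h := x) (q' := some .clear)
    (e := some (w x + 1, .out, .out)) (d := .left)
    (tape := markedTape N (truncate w x) (clearBeyond a) (clearBeyond b))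
    (by rw [markedTape_of_mem hx hxN, truncate, if_pos le_rfl]; exact if_neg hne)
    (update_markedTape hx hxN _ _ _).symm
  refine (hsweep.trans hletter).trans (reaches_patternCfg_one (by simp only [TM.shift]; omega)
    (by simp only [TM.shift]; omega) fun z hz _ => ?_)
  rcases eq_or_ne z x with rfl | hzx
  · simp
  · have hxz : x < z := by simp only [TM.shift] at hz; omega
    simp [clearBeyond, hzx, hxz.not_ge]

theorem reaches_halt_of_forall_last {N : ℤ} (hN : 0 ≤ N)
    (hlast : ∀ z, 1 ≤ z → z ≤ N → w z = Fin.last K) :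
    (machine K).Reaches ⟨some .incr, N, markedTape N w a b⟩
      ⟨none, -1, markedTape N (fun _ => 0) (fun _ => .out) fun _ => .out⟩ :=
  (reaches_sweep_last le_rfl hN (fun z hz hzN => ⟨hlast z (by omega) hzN, rfl, rfl, rfl⟩)
    fun _ _ _ => by omega).trans
    ((machine K).reaches_step (d := .left) (by rw [markedTape_of_notMem (by omega)]; rfl)
      (update_markedTape_of_notMem (by omega)).symm)

theorem reaches_halt {N : ℕ} {w : ℤ → Fin (K + 1)} (hN : N ≤ Friedman.longest (K + 1) + 1)
    (h : NoEarlierStar w N) :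
    (machine K).Reaches (patternCfg N w 1)
      ⟨none, -1, markedTape (Friedman.longest (K + 1) + 1 : ℕ) (fun _ => 0) (fun _ => .out)
        fun _ => .out⟩ := by
  by_cases hstar : Friedman.Star (segment w 1 N)
  · have hle : N ≤ Friedman.longest (K + 1) :=
      (Friedman.isGreatest_longest (K + 1)).2 (mem_starLengths_iff.2 ⟨w, hstar⟩)
    exact (reaches_append_of_star hstar).trans (reaches_halt (by omega) h.append)
  obtain ⟨a, b, hincr⟩ := reaches_incr_of_not_star hstar
  by_cases hlast : ∀ z : ℤ, 1 ≤ z → z ≤ N → w z = Fin.last K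
  · obtain rfl := h.eq_longest_add_one hstar hlast hN
    exact hincr.trans (reaches_halt_of_forall_last (by omega) hlast)
  · push Not at hlast
    obtain ⟨z, hz⟩ := hlast
    obtain ⟨x, ⟨hx, hxN, hne⟩, hmax⟩ := Int.exists_greatest_of_bdd
      (P := fun z => 1 ≤ z ∧ z ≤ N ∧ w z ≠ Fin.last K) ⟨N, fun z hz => hz.2.1⟩ ⟨z, hz⟩
    have hbeyond (z : ℤ) (hxz : x < z) (hz : z ≤ N) : w z = Fin.last K :=
      by_contra fun hzne => (hmax z ⟨by omega, hz, hzne⟩).not_gt hxz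
    have hindex := index_next hx hxN hne hbeyond
    have := index_lt (next w x) N
    exact (hincr.trans (reaches_next hx hxN hne hbeyond)).trans
      (reaches_halt hN fun u hu => h.not_star_of_le hstar (by omega))
termination_by (Friedman.longest (K + 1) + 1 - N, (K + 1) ^ N - index w N)

theorem outputs_longest (K : ℕ) : (machine K).Outputs (Friedman.longest (K + 1)) := by
  have hinit : (machine K).init = ⟨some .clear, 0,
      markedTape 0 (fun _ => 0) (fun _ => .out) fun _ => .out⟩ := by
    rw [markedTape_zero]; rfl
  refine ⟨_, _, hinit ▸ (reaches_patternCfg_one le_rfl le_rfl fun _ _ _ => by omega).trans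
    (reaches_halt (N := 0) (Nat.zero_le _) fun u hu => by simp [index] at hu), 1,
    fun _ => some (0, .out, .out), 1, ⟨0, by simp [machine]⟩, fun j hj i => ?_, fun h => ?_,
    fun h => ?_⟩
  · exact markedTape_of_mem (by omega) (by omega)
  · simpa [markedTape] using h 0
  · simpa [markedTape] using h 0

end Search

end Searcher

/-! ### Two cells for a symbol -/

namespace Searcher

/-- A cell of the pair machine that holds a letter, and whether it is still to be matched in the
text. -/
abbrev LetterCell (K : ℕ) := Fin (K + 1) × Bool

/-- A cell of the pair machine that holds the marks of a letter: its mark in the pattern and whether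
it belongs to the text; or `none` after the last letter and before the first one. -/
abbrev MarkCell := Option (Mark × Bool)

/-- A symbol of the search machine takes two cells, the text mark being split between them. -/
def split {K : ℕ} : Symbol K → LetterCell K × MarkCell
  | none => ((0, false), none)
  | some (l, a, b) => ((l, b = .fresh), some (a, b ≠ .out))

/-- The states of the pair machine on a letter cell. -/
inductive LetterState (K : ℕ)
  | seek
  | seekEnd
  | carry (c : Fin (K + 1))
  | back
  | resetPass
  | resetFresh
  | moveText
  | growText
  | growText'
  | dropText
  | movePat
  | growPat
  | growPat'
  | clear
  | incr
  deriving DecidableEq, Fintype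

/-- The states of the pair machine on a mark cell. -/
inductive MarkState (K : ℕ)
  | seek (l : Fin (K + 1))
  | carry (c : Fin (K + 1))
  | back
  | reset
  | moveText
  | growText
  | growText'
  | dropText
  | movePat
  | growPat
  | growPat'
  | clear
  | incr
  deriving DecidableEq, Fintype

open Turing.Dir in
/-- The transitions of the pair machine on a letter cell. -/
def letterTrans {K : ℕ} : LetterState K → LetterCell K → MarkState K × LetterCell K × Turing.Dir
  | .seek, (l, f) => (.seek l, (l, f), right)
  | .seekEnd, e => (.incr, e, left)
  | .carry c, (l, f) => if l = c ∧ f then (.back, (l, false), left)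
    else (.carry c, (l, false), right)
  | .back, e => (.back, e, left)
  | .resetPass, e => (.reset, e, left)
  | .resetFresh, (l, _) => (.reset, (l, true), left)
  | .moveText, (l, _) => (.moveText, (l, false), right)
  | .growText, (l, _) => (.growText, (l, true), right)
  | .growText', (l, _) => (.growText', (l, true), right)
  | .dropText, (l, _) => (.dropText, (l, false), left)
  | .movePat, e => (.movePat, e, right)
  | .growPat, (l, _) => (.growPat, (l, true), right)
  | .growPat', (l, _) => (.growPat', (l, true), right)
  | .clear, (l, _) => (.clear, (l, false), left)
  | .incr, (l, _) => if l = Fin.last K then (.incr, (0, false), left)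
    else (.clear, (l + 1, false), left)

open Turing.Dir in
/-- The transitions of the pair machine on a mark cell. -/
def markTrans {K : ℕ} : MarkState K → MarkCell → Option (LetterState K) × MarkCell × Turing.Dir
  -- Only the letter `0` can stand before this cell. For the others the choice is free, and with
  -- this one the programs of the bit machine share states.
  | .seek l, none => if l = 0 then (some .seekEnd, none, left)
    else (some (.carry l), some (.used, false), right)
  | .seek l, some (.fresh, t) => (some (.carry l), some (.used, t), right)
  | .seek _, e => (some .seek, e, right)
  | .carry _, none => (some .resetPass, none, left)
  | .carry c, e => (some (.carry c), e, right)
  | .back, none => (some .seek, none, right)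
  | .back, e => (some .back, e, left)
  | .reset, none => (some .moveText, none, right)
  | .reset, some (a, true) => (some .resetFresh, some (a.refresh, true), left)
  | .reset, some (a, false) => (some .resetPass, some (a.refresh, false), left)
  | .moveText, some (a, true) => (some .growText, some (a, false), right)
  | .moveText, e => (some .moveText, e, right)
  | .growText, none => (some .dropText, none, left)
  | .growText, some (a, false) => (some .growText', some (a, true), right)
  | .growText, e => (some .growText, e, right)
  | .growText', none => (some .dropText, none, left)
  | .growText', some (a, _) => (some .back, some (a, true), left)
  | .dropText, none => (some .movePat, none, right)
  | .dropText, some (a, _) => (some .dropText, some (a, false), left)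
  | .movePat, none => (some .movePat, none, right)
  | .movePat, some (.out, t) => (some .movePat, some (.out, t), right)
  | .movePat, some (_, t) => (some .growPat, some (.out, t), right)
  | .growPat, none => (some .clear, some (.out, false), left)
  | .growPat, some (.out, _) => (some .growPat', some (.fresh, true), right)
  | .growPat, some _ => (some .growPat, some (.fresh, true), right)
  | .growPat', none => (some .clear, some (.out, false), left)
  | .growPat', some _ => (some .resetPass, some (.fresh, true), left)
  | .clear, none => (some .growPat, none, right)
  | .clear, some _ => (some .clear, some (.out, false), left)
  | .incr, none => (none, none, left)
  | .incr, some _ => (some .incr, some (.out, false), left)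

/-- The states of the pair machine. -/
abbrev PairState (K : ℕ) := LetterState K ⊕ MarkState K

/-- The direction in which the head moves when a state of the pair machine is entered. -/
def pairEnter {K : ℕ} : PairState K → Turing.Dir
  | .inl .seekEnd | .inl .back | .inl .resetPass | .inl .resetFresh | .inl .dropText
  | .inl .clear | .inl .incr => .left
  | .inr .back | .inr .reset | .inr .dropText | .inr .clear | .inr .incr => .left
  | _ => .right

/-- The first state of the pair machine on the two cells of a symbol. -/
def pairState {K : ℕ} : State K → PairState K
  | .seek => .inl .seek
  | .carry c => .inl (.carry c)
  | .back => .inr .back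
  | .reset => .inr .reset
  | .moveText => .inl .moveText
  | .growText => .inl .growText
  | .growText' => .inl .growText'
  | .dropText => .inr .dropText
  | .movePat => .inl .movePat
  | .growPat => .inl .growPat
  | .growPat' => .inl .growPat'
  | .clear => .inr .clear
  | .incr => .inr .incr

/-- The number of a mark. -/
def Mark.index : Mark → ℕ
  | .out => 0
  | .fresh => 1
  | .used => 2

/-- The mark with a given number. -/
def Mark.ofIndex : ℕ → Mark
  | 0 => .out
  | 1 => .fresh
  | _ => .used

section Pairs

variable {K m : ℕ} [NeZero m]

/-- The symbol for a letter cell, one of `2 (K + 1)`. -/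
def ofLetterCell (x : LetterCell K) : Fin m := Fin.ofNat m (2 * x.1 + x.2.toNat)

/-- The symbol for a mark cell, one of `7`. -/
def ofMarkCell : MarkCell → Fin m
  | none => 0
  | some (a, t) => Fin.ofNat m (2 * a.index + t.toNat + 1)

/-- The letter cell that a symbol stands for. -/
def toLetterCell (x : Fin m) : LetterCell K := (Fin.ofNat (K + 1) (x / 2), x.val.bodd)

/-- The mark cell that a symbol stands for. -/
def toMarkCell (x : Fin m) : MarkCell :=
  if x = 0 then none else some (.ofIndex ((x - 1) / 2), !x.val.bodd)

/-- The pair machine. The same `m` symbols are used for the letter cells and for the mark cells. -/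
def pairMachine (K m : ℕ) [NeZero m] : Mach (PairState K) (Fin m) where
  start := .inr .clear
  blank := 0
  trans
    | .inl q, x =>
      let (q', e, d) := letterTrans q (toLetterCell x)
      (some (.inr q'), ofLetterCell e, d)
    | .inr q, x =>
      let (q', e, d) := markTrans q (toMarkCell x)
      (q'.map .inl, ofMarkCell e, d)

/-- The two cells of a symbol. -/
def pairCode (e : Symbol K) : Fin 2 → Fin m := ![ofLetterCell (split e).1, ofMarkCell (split e).2]

end Pairs

/-- `pairMachine K m` simulates the step of the search machine from the state `q` on the symbol
`e`. -/
abbrev PairStep (K m : ℕ) [NeZero m] (q : State K) (e : Symbol K) : Prop :=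
  (machine K).CodesStep (pairMachine K m) pairState (pairEnter ∘ pairState) pairCode 3 q e

set_option maxRecDepth 10000 in
theorem pairStep_two_seven : ∀ q e, PairStep 2 7 q e := by decide +kernel

set_option maxRecDepth 10000 in
theorem pairStep_three_eight : ∀ q e, PairStep 3 8 q e := by decide +kernel

theorem pairCode_two_seven_injective : Function.Injective (pairCode (K := 2) (m := 7)) := by
  decide +kernel

theorem pairCode_three_eight_injective : Function.Injective (pairCode (K := 3) (m := 8)) := by
  decide +kernel

theorem pairCode_blank (K m : ℕ) [NeZero m] :
    pairCode (machine K).blank = fun _ => (pairMachine K m).blank := by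
  funext i
  fin_cases i <;> simp [pairCode, machine, split, ofLetterCell, ofMarkCell, pairMachine]

theorem outputs_pairMachine {K m v : ℕ} [NeZero m] (h : (machine K).Outputs v)
    (hcode : Function.Injective (pairCode (K := K) (m := m))) (hstep : ∀ q e, PairStep K m q e) :
    (pairMachine K m).Outputs v :=
  h.of_codesStep (M' := pairMachine K m) rfl hcode (pairCode_blank K m) hstep

theorem pairEnter_letterTrans {K : ℕ} (q : LetterState K) (x : LetterCell K) :
    pairEnter (.inr (letterTrans q x).1) = (letterTrans q x).2.2 := by
  rcases q with _ | _ | c | _ <;> simp only [letterTrans] <;> (try split_ifs) <;> rfl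

theorem pairEnter_markTrans {K : ℕ} (q : MarkState K) (x : MarkCell) :
    ∀ q' ∈ (markTrans q x).1, pairEnter (.inl q') = (markTrans q x).2.2 := by
  rcases x with _ | ⟨_ | _ | _, _ | _⟩ <;> cases q <;> simp [markTrans, pairEnter]
  split_ifs <;> simp

theorem pairEnter_trans {K m : ℕ} [NeZero m] (q : PairState K) (x : Fin m) :
    ∀ q' ∈ ((pairMachine K m).trans q x).1, pairEnter q' = ((pairMachine K m).trans q x).2.2 := by
  intro q' hq'
  rcases q with q | q
  · obtain rfl := Option.some.inj hq'
    exact pairEnter_letterTrans q _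
  · obtain ⟨s, hs, rfl⟩ := Option.map_eq_some_iff.1 hq'
    exact pairEnter_markTrans q _ s hs

theorem existsOfSize_twoState {K m v r n n' : ℕ} [NeZero m] (h : (pairMachine K m).Outputs v)
    (hr : ∀ d, (Finset.univ.filter fun q : PairState K => pairEnter q = d).card ≤ r + 1)
    (hn : 2 ≤ n) (hn' : m * (4 * r + 5) ≤ n') : TM.ExistsOfSize n n' v :=
  TwoState.existsOfSize h hr rfl pairEnter_trans hn (by simpa)

end Searcher

/-! ### Three bits for a cell -/

/-- A program for rewriting a word over the two symbols `false` and `true` on the tape. It is at the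
same time the state of a machine that still has to carry it out. `scan w₀ d₀ p₀ w₁ d₁ p₁` reads a
bit `b`, writes `w_b`, moves in the direction `d_b` and goes on with `p_b`; `goto q` hands over to
the state `q` of the machine that is to be coded. -/
inductive Prog (Q : Type*)
  | goto (q : Option Q)
  | scan (w₀ : Bool) (d₀ : Turing.Dir) (p₀ : Prog Q) (w₁ : Bool) (d₁ : Turing.Dir) (p₁ : Prog Q)
  deriving DecidableEq

namespace Prog

variable {Q : Type*}

section Machine

/-- The state in which a machine goes on with a program, where `program q` is the program
for `q`. -/
def enter (program : Q → Prog Q) : Prog Q → Option (Prog Q)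
  | goto q => q.map program
  | p => some p

/-- The machine that carries out programs, where `program q` is the program for `q`. Equal programs
being equal states, the programs for different `q` share what they have in common. -/
def machine (program : Q → Prog Q) (q₀ : Q) : Mach (Prog Q) Bool where
  start := program q₀
  blank := false
  trans
    | goto _, b => (none, b, .right)
    | scan w₀ d₀ p₀ _ _ _, false => (p₀.enter program, w₀, d₀)
    | scan _ _ _ w₁ d₁ p₁, true => (p₁.enter program, w₁, d₁)

variable [DecidableEq Q]

/-- The programs that are left at some time in carrying out a program, up to its end. -/
def subprograms : Prog Q → Finset (Prog Q)
  | goto _ => ∅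
  | scan w₀ d₀ p₀ w₁ d₁ p₁ =>
    insert (scan w₀ d₀ p₀ w₁ d₁ p₁) (p₀.subprograms ∪ p₁.subprograms)

theorem subprograms_subset {p r : Prog Q} (h : p ∈ r.subprograms) :
    p.subprograms ⊆ r.subprograms := by
  induction r with
  | goto q => simp [subprograms] at h
  | scan w₀ d₀ p₀ w₁ d₁ p₁ ih₀ ih₁ =>
    rw [subprograms, Finset.mem_insert, Finset.mem_union] at h
    rcases h with rfl | h | h
    · rfl
    · exact (ih₀ h).trans (Finset.subset_union_left.trans (Finset.subset_insert _ _))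
    · exact (ih₁ h).trans (Finset.subset_union_right.trans (Finset.subset_insert _ _))

/-- The programs that occur in the programs `program q`. -/
def allSubprograms [Fintype Q] (program : Q → Prog Q) : Finset (Prog Q) :=
  Finset.univ.biUnion fun q => (program q).subprograms

theorem closedUnder_machine [Fintype Q] {program : Q → Prog Q}
    (hprogram : ∀ q, program q ∈ (program q).subprograms) (q₀ : Q) :
    (machine program q₀).ClosedUnder (allSubprograms program) := by
  have hmem (q : Q) : program q ∈ allSubprograms program :=
    Finset.mem_biUnion.2 ⟨q, Finset.mem_univ q, hprogram q⟩
  have henter {p p' : Prog Q} (hp : p.subprograms ⊆ allSubprograms program)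
      (hp' : p' ∈ p.enter program) : p' ∈ allSubprograms program := by
    cases p with
    | goto q =>
      obtain ⟨q, rfl, rfl⟩ := Option.map_eq_some_iff.1 hp'
      exact hmem q
    | scan =>
      obtain rfl := Option.some.inj hp'
      exact hp (Finset.mem_insert_self _ _)
  refine ⟨hmem q₀, fun p hp b p' hp' => ?_⟩
  obtain ⟨q, hq, hpq⟩ := Finset.mem_biUnion.1 hp
  have hsub : p.subprograms ⊆ allSubprograms program :=
    (subprograms_subset hpq).trans
      (Finset.subset_biUnion_of_mem (fun q => (program q).subprograms) hq)
  cases p with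
  | goto q => simp [machine] at hp'
  | scan w₀ d₀ p₀ w₁ d₁ p₁ =>
    have hsub' := (Finset.subset_insert _ _).trans hsub
    cases b with
    | false => exact henter (Finset.subset_union_left.trans hsub') hp'
    | true => exact henter (Finset.subset_union_right.trans hsub') hp'

end Machine

section Compile

/-- What to do if a certain word is found: on the cells not yet passed, replace `unread` by
`target`; on the cells already passed, from the last one back, write the bits of `pending`; then
leave the word in the direction `exit`, for the state `next`. -/
structure WordTask (Q : Type*) where
  unread : List Bool
  target : List Bool
  pending : List (Option Bool)
  exit : Turing.Dir
  next : Option Q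

/-- The task of replacing the word `u` by the word `v`, when entering it in the direction `d`. -/
def WordTask.replace (d : Turing.Dir) (u v : List Bool) (exit : Turing.Dir) (next : Option Q) :
    WordTask Q :=
  match d with
  | .left => ⟨u.reverse, v.reverse, [], exit, next⟩
  | .right => ⟨u, v, [], exit, next⟩

/-- The task that remains after passing a cell and writing `w` on it. -/
def WordTask.pass (w : Bool) (t : WordTask Q) : WordTask Q where
  unread := t.unread.tail
  target := t.target.tail
  pending := (if t.target.head? = some w then none else t.target.head?) :: t.pending
  exit := t.exit
  next := t.next

/-- The value that `f` takes on all members of a nonempty list. -/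
def commonValue {α β : Type*} [DecidableEq β] (f : α → β) : List α → Option β
  | [] => none
  | a :: as => if ∀ a' ∈ as, f a' = f a then some (f a) else none

/-- The bit to be written on reading the bit `b`, and the tasks that remain then. A bit that is not
expected by any task is treated like the other one, which saves states. -/
def readBit (b : Bool) (ts : List (WordTask Q)) : Bool × List (WordTask Q) :=
  let ts := match ts.filter fun t => t.unread.head? = some b with
    | [] => ts
    | ts' => ts'
  let w := ((commonValue (fun t => t.target.head?) ts).join).getD b
  (w, ts.map (WordTask.pass w))

/-- Move in the direction `d` over cells on which the given bits are written. -/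
def walk (d : Turing.Dir) (ws : List (Option Bool)) (p : Prog Q) : Prog Q :=
  match ws with
  | [] => p
  | w :: ws => scan (w.getD false) d (walk d ws p) (w.getD true) d (walk d ws p)

variable [DecidableEq Q]

/-- The next move and the program after it, if the tasks agree and, with `n` cells not yet passed,
the word can be left without reading on: by going back, by going on if no corrections are pending,
or, on the last cell, by going back and forth. -/
def finish (d : Turing.Dir) (n : ℕ) (ts : List (WordTask Q)) : Option (Turing.Dir × Prog Q) :=
  if ∀ t ∈ ts, t.unread = t.target then
    (commonValue (fun t => (t.pending, t.exit, t.next)) ts).bind fun (pending, exit, q) =>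
      if exit ≠ d then
        some (exit, walk exit pending.tail (goto q))
      else if ∀ w ∈ pending, w = none then
        some (d, walk d (List.replicate n none) (goto q))
      else if n = 0 then
        some (Mach.opposite d, walk (Mach.opposite d) pending.tail.dropLast
          (walk d (pending.getLastD none :: List.replicate pending.tail.length none) (goto q)))
      else none
  else none

/-- A program for a list of tasks that concern different words of length `n`, entered in the
direction `d`. -/
def compile (d : Turing.Dir) (n : ℕ) (ts : List (WordTask Q)) : Prog Q :=
  match n with
  | 0 => goto none
  | n + 1 =>
    let branch (b : Bool) : Bool × Turing.Dir × Prog Q :=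
      let (w, ts') := readBit b ts
      (w, (finish d n ts').getD (d, compile d n ts'))
    let (w₀, d₀, p₀) := branch false
    let (w₁, d₁, p₁) := branch true
    scan w₀ d₀ p₀ w₁ d₁ p₁

theorem compile_succ_mem_subprograms (d : Turing.Dir) (n : ℕ) (ts : List (WordTask Q)) :
    compile d (n + 1) ts ∈ (compile d (n + 1) ts).subprograms :=
  Finset.mem_insert_self _ _

end Compile

end Prog

namespace Searcher

/-- The code of a letter cell. -/
def letterBits {K : ℕ} (e : LetterCell K) : List Bool :=
  [e.1.val.testBit 1, e.1.val.testBit 0, e.2]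

/-- The code of a mark cell. -/
def markBits : MarkCell → List Bool
  | none => [false, false, false]
  | some (.out, t) => [true, false, t]
  | some (.fresh, t) => [false, true, t]
  | some (.used, t) => [true, true, t]

open Prog in
/-- The program for a state of the pair machine, on the three bits of a cell. -/
def bitProgram {K : ℕ} (q : PairState K) : Prog (PairState K) :=
  compile (pairEnter q) 3 <| match q with
    | .inl s => (List.finRange (K + 1) ×ˢ [false, true]).map fun e =>
      let (s', e', d) := letterTrans s e
      .replace (pairEnter q) (letterBits e) (letterBits e') d (some (.inr s'))
    | .inr s => (none :: ([.out, .fresh, .used] ×ˢ [false, true]).map some).map fun e =>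
      let (s', e', d) := markTrans s e
      .replace (pairEnter q) (markBits e) (markBits e') d (s'.map .inl)

/-- The pair machine with the letters and the marks coded by three bits each. -/
def bitMachine (K : ℕ) : Mach (Prog (PairState K)) Bool :=
  Prog.machine bitProgram (.inr .clear)

/-- The code of a symbol of the search machine. -/
def bitCode {K : ℕ} (e : Symbol K) (i : Fin 6) : Bool :=
  (letterBits (split e).1 ++ markBits (split e).2).getD i false

/-- `bitMachine K` simulates the step of the search machine from the state `q` on the symbol `e`. -/
abbrev BitStep (K : ℕ) (q : State K) (e : Symbol K) : Prop :=
  (machine K).CodesStep (bitMachine K) (bitProgram ∘ pairState) (pairEnter ∘ pairState) bitCode 24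
    q e

set_option maxRecDepth 100000 in
theorem bitStep_two : ∀ q e, BitStep 2 q e := by decide +kernel

set_option maxRecDepth 100000 in
theorem bitStep_three : ∀ q e, BitStep 3 q e := by decide +kernel

theorem bitCode_two_injective : Function.Injective (bitCode (K := 2)) := by decide +kernel

theorem bitCode_three_injective : Function.Injective (bitCode (K := 3)) := by decide +kernel

theorem card_bitProgram_two : (Prog.allSubprograms (bitProgram (K := 2))).card ≤ 155 := by
  decide +kernel

theorem card_bitProgram_three : (Prog.allSubprograms (bitProgram (K := 3))).card ≤ 160 := by
  decide +kernel

theorem bitCode_blank (K : ℕ) : bitCode (machine K).blank = fun _ => (bitMachine K).blank := by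
  funext i
  fin_cases i <;> simp [bitCode, machine, split, letterBits, markBits, bitMachine, Prog.machine]

theorem existsOfSize_bitMachine {K v n m : ℕ} (h : (machine K).Outputs v)
    (hcode : Function.Injective (bitCode (K := K))) (hstep : ∀ q e, BitStep K q e)
    (hn : (Prog.allSubprograms (bitProgram (K := K))).card ≤ n) (hm : 2 ≤ m) :
    TM.ExistsOfSize n m v :=
  (h.of_codesStep (M' := bitMachine K) rfl hcode (bitCode_blank K) hstep).existsOfSize
    (Prog.closedUnder_machine (fun _ => Prog.compile_succ_mem_subprograms _ _ _) _) hn hm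

section Sizes

variable {n m : ℕ}

theorem outputs_pairMachine_three : (pairMachine 2 7).Outputs (Friedman.longest 3) :=
  outputs_pairMachine (outputs_longest 2) pairCode_two_seven_injective pairStep_two_seven

theorem outputs_pairMachine_four : (pairMachine 3 8).Outputs (Friedman.longest 4) :=
  outputs_pairMachine (outputs_longest 3) pairCode_three_eight_injective pairStep_three_eight

theorem existsOfSize_twoState_three (hn : 2 ≤ n) (hm : 623 ≤ m) :
    TM.ExistsOfSize n m (Friedman.longest 3) :=
  existsOfSize_twoState (r := 21) outputs_pairMachine_three (by decide) hn hm

theorem existsOfSize_twoState_four (hn : 2 ≤ n) (hm : 808 ≤ m) :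
    TM.ExistsOfSize n m (Friedman.longest 4) :=
  existsOfSize_twoState (r := 24) outputs_pairMachine_four (by decide) hn hm

theorem existsOfSize_pairMachine_three (hn : 34 ≤ n) (hm : 7 ≤ m) :
    TM.ExistsOfSize n m (Friedman.longest 3) :=
  outputs_pairMachine_three.existsOfSize_of_card_le hn (by simpa)

theorem existsOfSize_pairMachine_four (hn : 37 ≤ n) (hm : 8 ≤ m) :
    TM.ExistsOfSize n m (Friedman.longest 4) :=
  outputs_pairMachine_four.existsOfSize_of_card_le hn (by simpa)

theorem existsOfSize_bitMachine_three (hn : 155 ≤ n) (hm : 2 ≤ m) :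
    TM.ExistsOfSize n m (Friedman.longest 3) :=
  existsOfSize_bitMachine (outputs_longest 2) bitCode_two_injective bitStep_two
    (card_bitProgram_two.trans hn) hm

theorem existsOfSize_bitMachine_four (hn : 160 ≤ n) (hm : 2 ≤ m) :
    TM.ExistsOfSize n m (Friedman.longest 4) :=
  existsOfSize_bitMachine (outputs_longest 3) bitCode_three_injective bitStep_three
    (card_bitProgram_three.trans hn) hm

end Sizes

end Searcher

theorem mainTheorem1 :
    -- the machines for `n(3)`
    (TM.ExistsOfSize 2 1840 (Friedman.longest 3) ∧
      TM.ExistsOfSize 3 1080 (Friedman.longest 3) ∧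
      TM.ExistsOfSize 9 800 (Friedman.longest 3) ∧
      TM.ExistsOfSize 44 8 (Friedman.longest 3) ∧
      TM.ExistsOfSize 54 7 (Friedman.longest 3) ∧
      TM.ExistsOfSize 155 3 (Friedman.longest 3) ∧
      TM.ExistsOfSize 276 2 (Friedman.longest 3)) ∧
    -- the machines for `n(4)`
    (TM.ExistsOfSize 2 2450 (Friedman.longest 4) ∧
      TM.ExistsOfSize 3 1440 (Friedman.longest 4) ∧
      TM.ExistsOfSize 9 1030 (Friedman.longest 4) ∧
      TM.ExistsOfSize 47 10 (Friedman.longest 4) ∧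
      TM.ExistsOfSize 58 9 (Friedman.longest 4) ∧
      TM.ExistsOfSize 160 4 (Friedman.longest 4) ∧
      TM.ExistsOfSize 353 3 (Friedman.longest 4) ∧
      TM.ExistsOfSize 922 2 (Friedman.longest 4)) :=
  ⟨⟨Searcher.existsOfSize_twoState_three le_rfl (by norm_num),
      Searcher.existsOfSize_twoState_three (by norm_num) (by norm_num),
      Searcher.existsOfSize_twoState_three (by norm_num) (by norm_num),
      Searcher.existsOfSize_pairMachine_three (by norm_num) (by norm_num),
      Searcher.existsOfSize_pairMachine_three (by norm_num) le_rfl,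
      Searcher.existsOfSize_bitMachine_three le_rfl (by norm_num),
      Searcher.existsOfSize_bitMachine_three (by norm_num) le_rfl⟩,
    Searcher.existsOfSize_twoState_four le_rfl (by norm_num),
    Searcher.existsOfSize_twoState_four (by norm_num) (by norm_num),
    Searcher.existsOfSize_twoState_four (by norm_num) (by norm_num),
    Searcher.existsOfSize_pairMachine_four (by norm_num) (by norm_num),
    Searcher.existsOfSize_pairMachine_four (by norm_num) (by norm_num),
    Searcher.existsOfSize_bitMachine_four le_rfl (by norm_num),
    Searcher.existsOfSize_bitMachine_four (by norm_num) (by norm_num),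
    Searcher.existsOfSize_bitMachine_four (by norm_num) le_rfl⟩
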